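/- \textbf{Corollary (Generic branching at the edge).} Let $L:\mathbb R^d\to\mathbb R$ be $C^4$ near a nondegenerate critical point $\bar w$, i.e. $\nabla L(\bar w)=0$ and $H=\nabla^2L(\bar w)$ is invertible. Put $$\mathcal Q(a)=\tfrac16\nabla^4L(\bar w)[a,a,a,a]-\tfrac12\bigl\langle \nabla^3L(\bar w)[a,a,\cdot],\,H^{-1}\nabla^3L(\bar w)[a,a,\cdot]\bigr\rangle .$$ A period-two orbit of gradient descent with step size $\eta$ is a pair $x\ne y$ with $y=x-\eta\nabla L(x)$ and $x=y-\eta\nabla L(y)$; its amplitude is $a=(y-x)/2$ and its direction is $a/\|a\|$. Fix $\eta_c>0$, let $E_c=\ker(H-\frac{2}{\eta_c}I)$, and let $S(E_c)$ be the unit sphere of $E_c$. (1) Let $u\in S(E_c)$ be a nondegenerate critical point of $\mathcal Q|_{S(E_c)}$ with $\mathcal Q(u)\neq0$, and let $I=\{\eta>0:(\frac2\eta-\frac2{\eta_c})\mathcal Q(u)>0\}$. Then there are $\delta\in(0,\eta_c)$ and functions $c(\eta),a(\eta)\in\mathbb R^d$, $\alpha(\eta)\in\mathbb R$ such that for $\eta\in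 I$ with $|\eta-\eta_c|<\delta$ the pair $(c(\eta)-a(\eta),\,c(\eta)+a(\eta))$ is a period-two orbit depending continuously on $\eta$ and $\alpha(\eta)>0$, and, as $\eta\to\eta_c$ in $I$, $c(\eta)\to\bar w$, $$a(\eta)=\alpha(\eta)u+o\bigl(\sqrt{|\eta-\eta_c|}\bigr),\qquad \alpha(\eta)^2=\frac{\frac2\eta-\frac2{\eta_c}}{\mathcal Q(u)}+o(|\eta-\eta_c|).$$ The branch is unique up to swapping the two points and exists only on the side $I$: if $|\eta-\eta_c|<\delta$ and $(x,y)$ is a period-two orbit with $\|x-\bar w\|<\delta$, $\|y-\bar w\|<\delta$, whose direction is within $\delta$ of $u$ or of $-u$, then $\eta\in I$ and $(x,y)$ is $(c(\eta)-a(\eta),\,c(\eta)+a(\eta))$ or this pair swapped. (2) Every sufficiently small period-two orbit is tangent to a critical direction: for every $\varepsilon>0$ there is $\delta>0$ such that, if $|\eta-\eta_c|<\delta$ and $(x,y)$ is a period-two orbit for $\eta$ with $\|x-\bar w\|<\delta$ and $\|y-\bar w\|<\delta$, then the direction of $(x,y)$ is within $\varepsilon$ of some critical point of $\mathcal Q|_{S(E_c)}$.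 (3) If $\dim E_c=1$, then every $u\in S(E_c)$ is a nondegenerate critical point of $\mathcal Q|_{S(E_c)}$, so that (1) holds whenever $\mathcal Q(u)\ne0$. -/

import Mathlib

open Filter Topology Asymptotics

noncomputable section

namespace EdgeBranching

variable {E : Type*} [NormedAddCommGroup E] [InnerProductSpace ℝ E] [CompleteSpace E]

/-- `(x, y)` is a (genuine) period-two orbit of gradient descent on `L` with step size `η`. -/
structure IsPeriodTwoOrbit (L : E → ℝ) (η : ℝ) (x y : E) : Prop where
  ne : x ≠ y
  step_left : y = x - η • gradient L x
  step_right : x = y - η • gradient L y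

/-- The Hessian of `L` at `w`, as an operator: the derivative of the gradient field. -/
def hess (L : E → ℝ) (w : E) : E →L[ℝ] E := fderiv ℝ (gradient L) w

/-- The vector `∇³L(w)[a, a, ·]`, i.e. the second derivative of the gradient field at `w`
in the directions `a, a`. -/
def thirdVec (L : E → ℝ) (w a : E) : E := iteratedFDeriv ℝ 2 (gradient L) w (fun _ => a)

/-- The quartic
`Q(a) = (1/6) ∇⁴L(w)[a,a,a,a] - (1/2) ⟨∇³L(w)[a,a,·], H⁻¹ ∇³L(w)[a,a,·]⟩`, `H = ∇²L(w)`. -/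
def quartic (L : E → ℝ) (w a : E) : ℝ :=
  (1 / 6) * iteratedFDeriv ℝ 4 L w (fun _ => a)
    - (1 / 2) * inner ℝ (thirdVec L w a) ((hess L w).inverse (thirdVec L w a))

/-- `E_c = ker (H - (2/η_c) I)`. -/
def critSpace (L : E → ℝ) (w : E) (ηc : ℝ) : Submodule ℝ E :=
  LinearMap.ker ((hess L w - (2 / ηc) • ContinuousLinearMap.id ℝ E : E →L[ℝ] E) : E →ₗ[ℝ] E)

/-- The tangent space at `u` of the unit sphere of the subspace `F`. -/
def sphereTangent (F : Submodule ℝ E) (u : E) : Submodule ℝ E := F ⊓ (Submodule.span ℝ {u})ᗮ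

/-- The restriction of `f` to the unit sphere of `F`, read in the chart
`v ↦ (u + v) / ‖u + v‖` (central projection from the tangent space at `u`). -/
def sphereLocal (f : E → ℝ) (F : Submodule ℝ E) (u : E) : sphereTangent F u → ℝ :=
  fun v => f (‖u + (v : E)‖⁻¹ • (u + (v : E)))

/-- `u` is a critical point of the restriction of `f` to the unit sphere of `F`. -/
structure IsSphereCritical (f : E → ℝ) (F : Submodule ℝ E) (u : E) : Prop where
  mem : u ∈ F
  norm_eq : ‖u‖ = 1
  fderiv_eq : fderiv ℝ (sphereLocal f F u) 0 = 0

/-- `u` is a nondegenerate critical point of the restriction of `f` to the unit sphere of `F`: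
the second derivative in the chart is a nondegenerate bilinear form on the tangent space. -/
structure IsSphereNondegenerate (f : E → ℝ) (F : Submodule ℝ E) (u : E) : Prop
    extends IsSphereCritical f F u where
  nondegenerate : ∀ v : sphereTangent F u,
    (∀ v' : sphereTangent F u, fderiv ℝ (fderiv ℝ (sphereLocal f F u)) 0 v v' = 0) → v = 0

/-- The step sizes `η > 0` with `(2/η - 2/η_c) q > 0`. -/
def branchSide (ηc q : ℝ) : Set ℝ := {η | 0 < η ∧ 0 < (2 / η - 2 / ηc) * q}

/-- The unit vector in the direction of the half-difference `(y - x)/2` of a pair `(x, y)`. -/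
def direction (x y : E) : E := ‖y - x‖⁻¹ • (y - x)

end EdgeBranching

end

/-! Write an orbit as `w + h ∓ a` and put `g = gradient L`. The orbit equations become `g (w + h +
a) = (2/η) a` and `g (w + h - a) = -(2/η) a`. Their sum determines the midpoint: `H h + ½ T(a,a)`
vanishes to leading order, so `h ≈ center a`, of size `‖a‖²`. Substituting this in the difference
gives `H a + cubic a + o(‖a‖³) = (2/η) a`. Projected to `E_c = ker (H - 2/η_c)`, it says that `cubic
a - (2/η - 2/η_c) a` is orthogonal to `E_c` to leading order. Since `4 • cubic` is the gradient of
the quartic `Q`, this is the Lagrange multiplier equation for `Q` on the unit sphere of `E_c`: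
directions are critical points `u`, and the amplitude satisfies `α² Q(u) = 2/η - 2/η_c`.

Existence: set `s = √|2/η - 2/η_c|`, `h = s² b`, `a = s z` and divide out powers of `s`. As `g` is
only `C³`, the rescaled system need not extend smoothly to `s = 0`, but its derivative in `(b, z)`
converges as `s ↓ 0`. A parametrised inverse function argument
(`exists_continuousOn_zero_of_tendsto_fderiv`) then gives a unique continuous zero near the limit
point. The limiting derivative is injective by `eq_zero_of_cubicDeriv_eq`, where nondegeneracy of
`u` and `Q(u) ≠ 0` enter.

Tangency and uniqueness: along any ultrafilter of shrinking orbits, compactness makes the direction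
and the rescaled midpoint converge, and the limits must satisfy the reduced equation
(`HasJet.exists_tendsto_direction`). Hence every small orbit with direction near `u` lies in the
region where the blown-up zero is unique. -/

noncomputable section

namespace EdgeBranching

/-! ### Zeros of a family of maps as its parameter tends to zero -/

section

/-- Implicit function theorem for a family `F s`, `s ↓ 0`, which depends only continuously on the
parameter, and which need not be defined at `s = 0`. -/
theorem exists_continuousOn_zero_of_tendsto_fderiv {X : Type*} [NormedAddCommGroup X]
    [NormedSpace ℝ X] [CompleteSpace X] [Nontrivial X] {F : ℝ → X → X} {F' : ℝ → X → X →L[ℝ] X}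
    (A : X ≃L[ℝ] X) {ξ₀ : X}
    (hd : ∀ᶠ p : ℝ × X in 𝓝[>] 0 ×ˢ 𝓝 ξ₀, HasFDerivAt (F p.1) (F' p.1 p.2) p.2)
    (hc : ∀ᶠ p : ℝ × X in 𝓝[>] 0 ×ˢ 𝓝 ξ₀, ContinuousAt (fun s => F s p.2) p.1)
    (hF' : Tendsto (fun p : ℝ × X => F' p.1 p.2) (𝓝[>] 0 ×ˢ 𝓝 ξ₀) (𝓝 (A : X →L[ℝ] X)))
    (h0 : Tendsto (fun s => F s ξ₀) (𝓝[>] 0) (𝓝 0)) :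
    ∃ (ζ : ℝ → X) (s₀ ρ : ℝ), 0 < s₀ ∧ 0 < ρ ∧ ContinuousOn ζ (Set.Ioo 0 s₀) ∧
      Tendsto ζ (𝓝[>] 0) (𝓝 ξ₀) ∧ (∀ s ∈ Set.Ioo 0 s₀, F s (ζ s) = 0) ∧
      ∀ s ∈ Set.Ioo 0 s₀, ∀ ξ ∈ Metric.closedBall ξ₀ ρ, F s ξ = 0 → ξ = ζ s := by
  set N : ℝ := ‖(A.symm : X →L[ℝ] X)‖ with hN
  have hNpos : 0 < N := A.norm_symm_pos
  -- Any `c < N⁻¹` makes a `c`-Lipschitz perturbation of `A` injective. With half of `N⁻¹` the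
  -- inverse is `2N`-Lipschitz, and the image of the `ρ`-ball covers a ball of radius `(N⁻¹ - c) ρ =
  -- c ρ`, hence the bound in `hsmall`.
  set c : ℝ := N⁻¹ / 2 with hcdef
  have hcpos : 0 < c := by positivity
  have hev := (hd.and hc).and (hF'.eventually (Metric.ball_mem_nhds _ hcpos))
  obtain ⟨pa, hpa, pb, hpb, hab⟩ := eventually_prod_iff.1 hev
  obtain ⟨ρ, hρ, hρb⟩ := Metric.nhds_basis_closedBall.eventually_iff.1 hpb
  have hsmall : ∀ᶠ s in 𝓝[>] (0 : ℝ), ‖F s ξ₀‖ ≤ c * ρ := by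
    have := h0.norm
    rw [norm_zero] at this
    exact (this.eventually (gt_mem_nhds (by positivity : 0 < c * ρ))).mono fun _ h => h.le
  obtain ⟨s₀, hs₀, hs⟩ := (mem_nhdsGT_iff_exists_Ioo_subset).1 (hpa.and hsmall)
  have hs₀ : 0 < s₀ := hs₀
  have approx : ∀ s ∈ Set.Ioo 0 s₀, ∀ ξ ∈ Metric.closedBall ξ₀ ρ, ∀ ξ' ∈ Metric.closedBall ξ₀ ρ,
      ‖F s ξ - F s ξ' - A (ξ - ξ')‖ ≤ c * ‖ξ - ξ'‖ := by
    intro s hs' ξ hξ ξ' hξ'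
    refine Convex.norm_image_sub_le_of_norm_hasFDerivWithin_le' (φ := (A : X →L[ℝ] X))
      (s := Metric.closedBall ξ₀ ρ) (f' := F' s)
      (fun x hx => (hab (hs hs').1 (hρb hx)).1.1.hasFDerivWithinAt) (fun x hx => ?_)
      (convex_closedBall _ _) hξ' hξ
    have := (hab (hs hs').1 (hρb hx)).2
    rw [dist_eq_norm] at this
    exact this.le
  have anti : ∀ s ∈ Set.Ioo 0 s₀, ∀ ξ ∈ Metric.closedBall ξ₀ ρ, ∀ ξ' ∈ Metric.closedBall ξ₀ ρ,
      ‖ξ - ξ'‖ ≤ 2 * N * ‖F s ξ - F s ξ'‖ := by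
    intro s hs' ξ hξ ξ' hξ'
    have h1 := approx s hs' ξ hξ ξ' hξ'
    have h2 : ‖ξ - ξ'‖ ≤ N * ‖A (ξ - ξ')‖ := by
      simpa using (A.symm : X →L[ℝ] X).le_opNorm (A (ξ - ξ'))
    have h3 : ‖A (ξ - ξ')‖ ≤ ‖F s ξ - F s ξ'‖ + c * ‖ξ - ξ'‖ := by
      have := norm_sub_norm_le (A (ξ - ξ')) (F s ξ - F s ξ')
      rw [norm_sub_rev (A (ξ - ξ'))] at this
      linarith
    have h4 : N * (c * ‖ξ - ξ'‖) = ‖ξ - ξ'‖ / 2 := by rw [hcdef]; field_simp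
    have h5 := mul_le_mul_of_nonneg_left h3 hNpos.le
    rw [mul_add, h4] at h5
    linarith
  have ex : ∀ s ∈ Set.Ioo 0 s₀, ∃ ξ ∈ Metric.closedBall ξ₀ ρ, F s ξ = 0 := by
    intro s hs'
    have hA : ApproximatesLinearOn (F s) (A : X →L[ℝ] X) (Metric.closedBall ξ₀ ρ) ⟨c, hcpos.le⟩ :=
      fun x hx y hy => approx s hs' x hx y hy
    have hsurj := hA.surjOn_closedBall_of_nonlinearRightInverse A.toNonlinearRightInverse
      hρ.le subset_rfl
    refine hsurj (a := 0) ?_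
    rw [Metric.mem_closedBall, dist_eq_norm, zero_sub, norm_neg]
    refine (hs hs').2.trans (le_of_eq ?_)
    have : ((A.toNonlinearRightInverse.nnnorm : NNReal) : ℝ) = N := rfl
    rw [this]
    change c * ρ = (N⁻¹ - c) * ρ
    rw [hcdef]; ring
  choose! ζ hζ hζ0 using ex
  have hcen : ξ₀ ∈ Metric.closedBall ξ₀ ρ := Metric.mem_closedBall_self hρ.le
  refine ⟨ζ, s₀, ρ, hs₀, hρ, fun s hs' => ?_, ?_, hζ0, fun s hs' ξ hξ h => ?_⟩
  · refine ContinuousAt.continuousWithinAt ?_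
    rw [ContinuousAt, tendsto_iff_norm_sub_tendsto_zero]
    -- Continuity in the parameter at the frozen point `ζ s` suffices, because `anti` bounds `‖ζ r -
    -- ζ s‖` by `2N ‖F r (ζ s)‖` and `F s (ζ s) = 0`.
    have hcont : ContinuousAt (fun r => F r (ζ s)) s := (hab (hs hs').1 (hρb (hζ s hs'))).1.2
    have hlim : Tendsto (fun r => 2 * N * ‖F r (ζ s)‖) (𝓝 s) (𝓝 0) := by
      have := hcont.tendsto.norm.const_mul (2 * N)
      simpa [hζ0 s hs'] using this
    refine squeeze_zero' (Eventually.of_forall fun _ => norm_nonneg _) ?_ hlim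
    filter_upwards [isOpen_Ioo.mem_nhds hs'] with r hr
    have := anti r hr _ (hζ r hr) _ (hζ s hs')
    rwa [hζ0 r hr, zero_sub, norm_neg] at this
  · rw [tendsto_iff_norm_sub_tendsto_zero]
    have hlim : Tendsto (fun r => 2 * N * ‖F r ξ₀‖) (𝓝[>] 0) (𝓝 0) := by
      simpa using h0.norm.const_mul (2 * N)
    refine squeeze_zero' (Eventually.of_forall fun _ => norm_nonneg _) ?_ hlim
    filter_upwards [Ioo_mem_nhdsGT hs₀] with r hr
    have := anti r hr _ (hζ r hr) _ hcen
    rwa [hζ0 r hr, zero_sub, norm_neg] at this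
  · have := anti s hs' _ hξ _ (hζ s hs')
    rw [h, hζ0 s hs', sub_zero, norm_zero, mul_zero] at this
    exact sub_eq_zero.1 (norm_le_zero_iff.1 this)

end

/-! ### Taylor expansions up to order three with little-o remainder -/

section

section Taylor

variable {E F : Type*} [NormedAddCommGroup E] [NormedSpace ℝ E] [NormedAddCommGroup F]
  [NormedSpace ℝ F]

/-- Mean value inequality on the ball of radius `‖k‖`. It drives an induction on the order: by
symmetry of higher derivatives, the derivative of a Taylor remainder of `f` is the remainder of
`fderiv ℝ f` of one order less. -/
theorem isLittleO_norm_pow_succ_of_hasFDerivAt {R : E → F} {R' : E → E →L[ℝ] F} {n : ℕ}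
    (h : ∀ᶠ k in 𝓝 0, HasFDerivAt R (R' k) k) (h0 : R 0 = 0)
    (hR' : R' =o[𝓝 0] fun k => ‖k‖ ^ n) : R =o[𝓝 0] fun k => ‖k‖ ^ (n + 1) := by
  refine isLittleO_iff.2 fun ε hε => ?_
  obtain ⟨ρ, hρ, hb⟩ := Metric.nhds_basis_ball.eventually_iff.1
    (h.and (isLittleO_iff.1 hR' hε))
  filter_upwards [Metric.ball_mem_nhds 0 hρ] with k hk
  have hsub : Metric.closedBall (0 : E) ‖k‖ ⊆ Metric.ball 0 ρ :=
    Metric.closedBall_subset_ball (by simpa using hk)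
  have := Convex.norm_image_sub_le_of_norm_hasFDerivWithin_le (f := R) (f' := R')
    (s := Metric.closedBall (0 : E) ‖k‖) (C := ε * ‖k‖ ^ n) (x := 0) (y := k)
    (fun x hx => (hb (hsub hx)).1.hasFDerivWithinAt) (fun x hx => ?_)
    (convex_closedBall _ _) (by simp) (by simp)
  · rw [h0, sub_zero, sub_zero] at this
    simpa [pow_succ, mul_assoc] using this
  · refine (hb (hsub hx)).2.trans ?_
    have hx' : ‖x‖ ≤ ‖k‖ := by simpa using hx
    rw [Real.norm_of_nonneg (by positivity)]
    gcongr

theorem eventually_contDiffAt_add {n : ℕ} {f : E → F} {w : E} (hf : ContDiffAt ℝ n f w) :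
    ∀ᶠ k in 𝓝 (0 : E), ContDiffAt ℝ n f (w + k) := by
  have ht : Tendsto (fun k : E => w + k) (𝓝 0) (𝓝 w) := by
    have : ContinuousAt (fun k : E => w + k) 0 := by fun_prop
    simpa [ContinuousAt] using this
  exact ht.eventually (hf.eventually (by simp))

theorem hasFDerivAt_comp_const_add {f : E → F} {w k : E} (hf : DifferentiableAt ℝ f (w + k)) :
    HasFDerivAt (fun k => f (w + k)) (fderiv ℝ f (w + k)) k := by
  exact (hasFDerivAt_comp_add_left w).2 hf.hasFDerivAt

theorem taylor_one {f : E → F} {w : E} (hf : DifferentiableAt ℝ f w) :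
    (fun k => f (w + k) - f w - fderiv ℝ f w k) =o[𝓝 0] fun k => ‖k‖ ^ 1 := by
  have := (hasFDerivAt_iff_isLittleO_nhds_zero.1 hf.hasFDerivAt).norm_right
  simpa using this

theorem taylor_two {f : E → F} {w : E} (hf : ContDiffAt ℝ 2 f w) :
    (fun k => f (w + k) - f w - fderiv ℝ f w k - (1 / 2 : ℝ) • fderiv ℝ (fderiv ℝ f) w k k)
      =o[𝓝 0] fun k => ‖k‖ ^ 2 := by
  have hsymm : IsSymmSndFDerivAt ℝ f w := hf.isSymmSndFDerivAt (by simp)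
  have hf1 : ContDiffAt ℝ 1 (fderiv ℝ f) w := hf.fderiv_right (by norm_num)
  refine isLittleO_norm_pow_succ_of_hasFDerivAt (n := 1)
    (R' := fun k => fderiv ℝ f (w + k) - fderiv ℝ f w - fderiv ℝ (fderiv ℝ f) w k) ?_ (by simp)
    (taylor_one (hf1.differentiableAt (by simp)))
  filter_upwards [eventually_contDiffAt_add (n := 2) hf] with k hk
  have h1 := hasFDerivAt_comp_const_add (hk.differentiableAt (by simp))
  have h2 := (fderiv ℝ (fderiv ℝ f) w).hasFDerivAt (x := k) |>.clm_apply (hasFDerivAt_id k)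
  have := ((h1.sub_const (f w)).sub (fderiv ℝ f w).hasFDerivAt).sub (h2.const_smul (1 / 2 : ℝ))
  refine this.congr_fderiv ?_
  ext v
  simp only [sub_apply, smul_apply,
    add_apply, ContinuousLinearMap.comp_apply, ContinuousLinearMap.flip_apply,
    ContinuousLinearMap.id_apply, id, hsymm.eq v k]
  module

/-- Symmetry of the second derivative holds throughout a neighbourhood, so it may be differentiated
in the direction `a`. -/
theorem fderiv_fderiv_fderiv_apply_comm {f : E → F} {w : E} (hf : ContDiffAt ℝ 3 f w) (a b c : E) :
    fderiv ℝ (fderiv ℝ (fderiv ℝ f)) w a b c = fderiv ℝ (fderiv ℝ (fderiv ℝ f)) w a c b := by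
  have hf2 : ContDiffAt ℝ 1 (fderiv ℝ (fderiv ℝ f)) w :=
    (hf.fderiv_right (m := 2) (by norm_num)).fderiv_right (by norm_num)
  have hd := (hf2.differentiableAt (by simp)).hasFDerivAt
  have key : ∀ b c : E, HasFDerivAt (fun x => fderiv ℝ (fderiv ℝ f) x b c)
      (((fderiv ℝ (fderiv ℝ (fderiv ℝ f)) w).flip b).flip c) w := fun b c => by
    have := (hd.clm_apply (hasFDerivAt_const b w)).clm_apply (hasFDerivAt_const c w)
    refine this.congr_fderiv ?_
    ext v; simp
  have heq : (fun x => fderiv ℝ (fderiv ℝ f) x b c) =ᶠ[𝓝 w]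
      fun x => fderiv ℝ (fderiv ℝ f) x c b := by
    filter_upwards [hf.eventually (by simp)] with x hx
    exact (hx.isSymmSndFDerivAt (by norm_num)).eq b c
  have := (key b c).unique ((key c b).congr_of_eventuallyEq heq)
  simpa using DFunLike.congr_fun this a

theorem taylor_three {f : E → F} {w : E} (hf : ContDiffAt ℝ 3 f w) :
    (fun k => f (w + k) - f w - fderiv ℝ f w k - (1 / 2 : ℝ) • fderiv ℝ (fderiv ℝ f) w k k
      - (1 / 6 : ℝ) • fderiv ℝ (fderiv ℝ (fderiv ℝ f)) w k k k)
      =o[𝓝 0] fun k => ‖k‖ ^ 3 := by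
  have hsymm : IsSymmSndFDerivAt ℝ f w := hf.isSymmSndFDerivAt (by norm_num)
  have hf1 : ContDiffAt ℝ 2 (fderiv ℝ f) w := hf.fderiv_right (by norm_num)
  have hsymm1 : IsSymmSndFDerivAt ℝ (fderiv ℝ f) w := hf1.isSymmSndFDerivAt (by simp)
  have hsymm2 := fderiv_fderiv_fderiv_apply_comm hf
  refine isLittleO_norm_pow_succ_of_hasFDerivAt (n := 2)
    (R' := fun k => fderiv ℝ f (w + k) - fderiv ℝ f w - fderiv ℝ (fderiv ℝ f) w k -
      (1 / 2 : ℝ) • fderiv ℝ (fderiv ℝ (fderiv ℝ f)) w k k) ?_ (by simp) (taylor_two hf1)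
  filter_upwards [eventually_contDiffAt_add (n := 3) hf] with k hk
  have h1 := hasFDerivAt_comp_const_add (hk.differentiableAt (by simp))
  have h2 := (fderiv ℝ (fderiv ℝ f) w).hasFDerivAt (x := k) |>.clm_apply (hasFDerivAt_id k)
  have h3 := ((fderiv ℝ (fderiv ℝ (fderiv ℝ f)) w).hasFDerivAt (x := k) |>.clm_apply
    (hasFDerivAt_id k)).clm_apply (hasFDerivAt_id k)
  have := (((h1.sub_const (f w)).sub (fderiv ℝ f w).hasFDerivAt).sub
    (h2.const_smul (1 / 2 : ℝ))).sub (h3.const_smul (1 / 6 : ℝ))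
  refine this.congr_fderiv ?_
  ext v
  simp only [sub_apply, smul_apply,
    add_apply, ContinuousLinearMap.comp_apply, ContinuousLinearMap.flip_apply,
    ContinuousLinearMap.id_apply, id, hsymm.eq v k, hsymm1.eq v k, hsymm2 k v k]
  module

end Taylor

end

/-! ### Algebra of the jet: the reduced cubic and its quartic potential on the sphere -/

section

/-- The derivatives of order one, two and three of a gradient field at a point where the first one
is invertible, with the symmetries they have as derivatives of a potential. -/
structure GradientJet (E : Type*) [NormedAddCommGroup E] [InnerProductSpace ℝ E] where
  H : E ≃L[ℝ] E
  T : E →L[ℝ] E →L[ℝ] E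
  K : E →L[ℝ] E →L[ℝ] E →L[ℝ] E
  inner_H : ∀ a b, inner ℝ (H a) b = inner ℝ a (H b)
  T_comm : ∀ a b, T a b = T b a
  inner_T : ∀ a b c, inner ℝ (T a b) c = inner ℝ b (T a c)
  K_comm_left : ∀ a b c, K a b c = K b a c
  K_comm_right : ∀ a b c, K a b c = K a c b
  inner_K : ∀ a b c d, inner ℝ (K a b c) d = inner ℝ c (K a b d)

namespace GradientJet

variable {E : Type*} [NormedAddCommGroup E] [InnerProductSpace ℝ E] (J : GradientJet E)

/-- The quadratic part `a ↦ -½ H⁻¹ T(a, a)` of the midpoint of a period-two orbit. -/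
def center (a : E) : E := -(1 / 2 : ℝ) • J.H.symm (J.T a a)

/-- The cubic part of the reduced equation for the half-difference of a period-two orbit. -/
def cubic (a : E) : E := J.T a (J.center a) + (1 / 6 : ℝ) • J.K a a a

/-- The derivative of `GradientJet.cubic`. -/
def cubicDeriv (a : E) : E →L[ℝ] E :=
  J.T.flip (J.center a) - (J.T a).comp ((J.H.symm : E →L[ℝ] E).comp (J.T a))
    + (1 / 2 : ℝ) • J.K a a

theorem cubicDeriv_apply (a h : E) : J.cubicDeriv a h =
    J.T h (J.center a) - J.T a (J.H.symm (J.T a h)) + (1 / 2 : ℝ) • J.K a a h := by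
  simp [cubicDeriv]

theorem H_center (a : E) : J.H (J.center a) + (1 / 2 : ℝ) • J.T a a = 0 := by
  simp [center]

theorem inner_H_symm (a b : E) : inner ℝ (J.H.symm a) b = inner ℝ a (J.H.symm b) := by
  have := J.inner_H (J.H.symm a) (J.H.symm b)
  simpa using this.symm

theorem hasFDerivAt_center (a : E) :
    HasFDerivAt J.center (-(J.H.symm : E →L[ℝ] E).comp (J.T a)) a := by
  have h := ((J.H.symm : E →L[ℝ] E).hasFDerivAt.comp a
    ((J.T.hasFDerivAt (x := a)).clm_apply (hasFDerivAt_id a))).const_smul (-(1 / 2 : ℝ))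
  refine h.congr_fderiv ?_
  ext v
  simp only [smul_apply, ContinuousLinearMap.comp_apply, add_apply, ContinuousLinearMap.flip_apply,
    ContinuousLinearMap.id_apply, id, neg_apply, J.T_comm v a, map_add]
  module

theorem hasFDerivAt_cubic (a : E) : HasFDerivAt J.cubic (J.cubicDeriv a) a := by
  have h1 := (J.T.hasFDerivAt (x := a)).clm_apply (J.hasFDerivAt_center a)
  have h2 := ((J.K.hasFDerivAt (x := a)).clm_apply (hasFDerivAt_id a)).clm_apply
    (hasFDerivAt_id a)
  refine (h1.add (h2.const_smul (1 / 6 : ℝ))).congr_fderiv ?_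
  ext v
  rw [cubicDeriv_apply]
  simp only [smul_apply, ContinuousLinearMap.comp_apply, add_apply, ContinuousLinearMap.flip_apply,
    ContinuousLinearMap.id_apply, id, neg_apply, map_neg, J.K_comm_left v a a,
    J.K_comm_right a v a, ContinuousLinearEquiv.coe_coe]
  module

theorem center_smul (t : ℝ) (a : E) : J.center (t • a) = t ^ 2 • J.center a := by
  simp only [center, map_smul, smul_apply, smul_smul]
  congr 1; ring

theorem cubic_smul (t : ℝ) (a : E) : J.cubic (t • a) = t ^ 3 • J.cubic a := by
  simp only [cubic, center_smul, map_smul, smul_apply, smul_smul, smul_add]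
  congr 2
  all_goals ring

theorem cubicDeriv_smul (t : ℝ) (a : E) : J.cubicDeriv (t • a) = t ^ 2 • J.cubicDeriv a := by
  ext h
  simp only [cubicDeriv_apply, center_smul, map_smul, smul_apply, smul_add, smul_sub, smul_smul]
  congr 2 <;> ring_nf

/-- Euler's identity for a map homogeneous of degree three. -/
theorem cubicDeriv_self (a : E) : J.cubicDeriv a a = (3 : ℝ) • J.cubic a := by
  rw [cubicDeriv_apply, cubic]
  have : J.H.symm (J.T a a) = (-2 : ℝ) • J.center a := by
    rw [center, smul_smul]; norm_num
  rw [this, map_smul]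
  module

/-- This makes `cubic` a gradient field. The operators `T(center a)`, `T(a) H⁻¹ T(a)` and `K(a, a)`
are each self-adjoint. -/
theorem inner_cubicDeriv (a h k : E) :
    inner ℝ (J.cubicDeriv a h) k = inner ℝ h (J.cubicDeriv a k) := by
  simp only [cubicDeriv_apply, inner_add_left, inner_sub_left, inner_add_right, inner_sub_right,
    inner_smul_left, inner_smul_right, J.inner_K]
  rw [J.inner_T a, J.inner_H_symm, J.inner_T a, J.T_comm h, J.T_comm k, J.inner_T]
  simp

/-- The quartic form `a ↦ ⟨cubic a, a⟩`, whose gradient is `4 • cubic`. -/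
def quart (a : E) : ℝ := inner ℝ (J.cubic a) a

theorem quart_smul (t : ℝ) (a : E) : J.quart (t • a) = t ^ 4 * J.quart a := by
  simp only [quart, cubic_smul, inner_smul_left, inner_smul_right]
  simp; ring

/-- The factor is `3 + 1`: self-adjointness moves `cubicDeriv a` onto `a`, where Euler's identity
gives `3 • cubic a`, and the other slot contributes `cubic a` once more. -/
theorem hasFDerivAt_quart (a : E) :
    HasFDerivAt J.quart ((4 : ℝ) • innerSL ℝ (J.cubic a)) a := by
  refine ((J.hasFDerivAt_cubic a).inner ℝ (hasFDerivAt_id a)).congr_fderiv ?_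
  ext v
  simp only [ContinuousLinearMap.comp_apply, ContinuousLinearMap.prod_apply,
    fderivInnerCLM_apply, smul_apply, innerSL_apply_apply, id, ContinuousLinearMap.id_apply]
  rw [J.inner_cubicDeriv, J.cubicDeriv_self, inner_smul_right, real_inner_comm v, smul_eq_mul]
  ring

variable {J} {F : Submodule ℝ E} {u : E}

theorem norm_add_sphereTangent_sq (hu : ‖u‖ = 1) (v : sphereTangent F u) :
    ‖u + (v : E)‖ ^ 2 = 1 + ‖v‖ ^ 2 := by
  have : inner ℝ u (v : E) = 0 := Submodule.mem_orthogonal_singleton_iff_inner_right.1 v.2.2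
  rw [norm_add_sq_real, this, hu]
  simp

/-- Homogeneity and Pythagoras: in the chart the normalisation becomes an explicit radial factor. -/
theorem sphereLocal_quart (hu : ‖u‖ = 1) (v : sphereTangent F u) :
    sphereLocal J.quart F u v = ((1 + ‖v‖ ^ 2) ^ 2)⁻¹ * J.quart (u + v) := by
  rw [sphereLocal, quart_smul, ← norm_add_sphereTangent_sq hu, ← pow_mul, inv_pow]

theorem hasFDerivAt_sphereLocal_quart (hu : ‖u‖ = 1) (v : sphereTangent F u) :
    HasFDerivAt (sphereLocal J.quart F u)
      (((1 + ‖v‖ ^ 2) ^ 2)⁻¹ • ((4 : ℝ) • (innerSL ℝ (J.cubic (u + v))).comp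
          (sphereTangent F u).subtypeL)
        + (J.quart (u + v) * (-4 * ((1 + ‖v‖ ^ 2) ^ 3)⁻¹)) • innerSL ℝ v) v := by
  have hpos : 0 < 1 + ‖v‖ ^ 2 := by positivity
  have h1 : HasFDerivAt (fun v : sphereTangent F u => ((1 + ‖v‖ ^ 2) ^ 2)⁻¹)
      ((-4 * ((1 + ‖v‖ ^ 2) ^ 3)⁻¹) • innerSL ℝ v) v := by
    have h := (hasStrictFDerivAt_norm_sq v).hasFDerivAt
    have hr : HasDerivAt (fun r : ℝ => ((1 + r) ^ 2)⁻¹)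
        (-(2 * (1 + ‖v‖ ^ 2)) / ((1 + ‖v‖ ^ 2) ^ 2) ^ 2) (‖v‖ ^ 2) := by
      have := (((hasDerivAt_id (‖v‖ ^ 2)).const_add 1).pow 2).inv
        (by simpa using hpos.ne')
      exact this.congr_deriv (by simp)
    refine (hr.comp_hasFDerivAt v h).congr_fderiv ?_
    ext x
    simp only [smul_apply, smul_eq_mul, innerSL_apply_apply, nsmul_eq_mul]
    field_simp
    norm_num
    ring
  have h2 : HasFDerivAt (fun v : sphereTangent F u => J.quart (u + v))
      ((4 : ℝ) • (innerSL ℝ (J.cubic (u + v))).comp (sphereTangent F u).subtypeL) v := by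
    have := (J.hasFDerivAt_quart (u + v)).comp v
      (((sphereTangent F u).subtypeL.hasFDerivAt (x := v)).const_add u)
    refine this.congr_fderiv ?_
    ext x; simp
  have := h1.mul h2
  refine (this.congr_fderiv ?_).congr_of_eventuallyEq
    (Eventually.of_forall fun v => sphereLocal_quart hu v)
  rw [← smul_smul (J.quart _)]

theorem fderiv_sphereLocal_quart_zero (hu : ‖u‖ = 1) (v : sphereTangent F u) :
    fderiv ℝ (sphereLocal J.quart F u) 0 v = 4 * inner ℝ (J.cubic u) (v : E) := by
  rw [(hasFDerivAt_sphereLocal_quart hu 0).fderiv]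
  simp

/-- The radial factors are stationary at `0`, and `innerSL ℝ v` vanishes there. What survives is the
derivative of `cubic` and that of `innerSL ℝ v`; the latter carries the Lagrange multiplier. -/
theorem fderiv_fderiv_sphereLocal_quart_zero (hu : ‖u‖ = 1) (v v' : sphereTangent F u) :
    fderiv ℝ (fderiv ℝ (sphereLocal J.quart F u)) 0 v v' =
      4 * inner ℝ (J.cubicDeriv u v) (v' : E) - 4 * J.quart u * inner ℝ (v : E) v' := by
  have heq : fderiv ℝ (sphereLocal J.quart F u) = fun v : sphereTangent F u =>
      ((1 + ‖v‖ ^ 2) ^ 2)⁻¹ • ((4 : ℝ) • (innerSL ℝ (J.cubic (u + v))).comp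
          (sphereTangent F u).subtypeL)
        + (J.quart (u + v) * (-4 * ((1 + ‖v‖ ^ 2) ^ 3)⁻¹)) • innerSL ℝ v :=
    funext fun v => (hasFDerivAt_sphereLocal_quart hu v).fderiv
  have hn := (hasStrictFDerivAt_norm_sq (0 : sphereTangent F u)).hasFDerivAt
  have hinv : ∀ n : ℕ, HasFDerivAt (fun v : sphereTangent F u => ((1 + ‖v‖ ^ 2) ^ n)⁻¹)
      (0 : sphereTangent F u →L[ℝ] ℝ) 0 := fun n => by
    have hr : DifferentiableAt ℝ (fun r : ℝ => ((1 + r) ^ n)⁻¹) (‖(0 : sphereTangent F u)‖ ^ 2) := by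
      refine DifferentiableAt.inv (by fun_prop) (by simp)
    have := hr.hasDerivAt.comp_hasFDerivAt 0 hn
    refine this.congr_fderiv ?_
    ext x; simp
  have hshift : HasFDerivAt (fun v : sphereTangent F u => u + (v : E))
      (sphereTangent F u).subtypeL 0 :=
    ((sphereTangent F u).subtypeL.hasFDerivAt (x := 0)).const_add u
  have hcub : HasFDerivAt (fun v : sphereTangent F u => J.cubic (u + v))
      ((J.cubicDeriv u).comp (sphereTangent F u).subtypeL) 0 := by
    have h : HasFDerivAt J.cubic (J.cubicDeriv u) (u + ((0 : sphereTangent F u) : E)) := by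
      simpa using J.hasFDerivAt_cubic u
    exact h.comp (0 : sphereTangent F u) hshift
  have hq : HasFDerivAt (fun v : sphereTangent F u => J.quart (u + v))
      (((4 : ℝ) • innerSL ℝ (J.cubic u)).comp (sphereTangent F u).subtypeL) 0 := by
    have h : HasFDerivAt J.quart ((4 : ℝ) • innerSL ℝ (J.cubic u))
        (u + ((0 : sphereTangent F u) : E)) := by
      simpa using J.hasFDerivAt_quart u
    exact h.comp (0 : sphereTangent F u) hshift
  have h1 := (hinv 2).smul ((((innerSL ℝ).hasFDerivAt.comp 0 hcub).clm_comp
    (hasFDerivAt_const (sphereTangent F u).subtypeL 0)).const_smul (4 : ℝ))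
  have h2 := (hq.mul ((hinv 3).const_mul (-4))).smul
    ((innerSL ℝ (E := sphereTangent F u)).hasFDerivAt (x := 0))
  have h12 := (h1.add h2).fderiv
  rw [heq]
  refine (DFunLike.congr_fun (DFunLike.congr_fun h12 v) v').trans ?_
  simp
  erw [innerSL_apply_apply, innerSL_apply_apply]
  rw [Submodule.coe_inner]
  ring

/-- Lagrange multiplier form of criticality. Testing with `e = u` identifies the multiplier as
`quart u`; tangent vectors are reached by removing the `u`-component of `e`. -/
theorem isSphereCritical_quart_iff (hF : u ∈ F) (hu : ‖u‖ = 1) :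
    IsSphereCritical J.quart F u ↔
      ∀ e ∈ F, inner ℝ (J.cubic u) e = J.quart u * inner ℝ u e := by
  have huu : inner ℝ u u = (1 : ℝ) := by rw [real_inner_self_eq_norm_sq, hu]; norm_num
  constructor
  · intro h e he
    have hv : e - inner ℝ u e • u ∈ sphereTangent F u := by
      refine ⟨F.sub_mem he (F.smul_mem _ hF), ?_⟩
      rw [SetLike.mem_coe, Submodule.mem_orthogonal_singleton_iff_inner_right, inner_sub_right,
        inner_smul_right, huu]
      ring
    have := fderiv_sphereLocal_quart_zero (J := J) hu ⟨_, hv⟩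
    rw [h.fderiv_eq] at this
    simp only [zero_apply, inner_sub_right, inner_smul_right] at this
    rw [quart]; linarith
  · refine fun h => ⟨hF, hu, ?_⟩
    ext v
    rw [fderiv_sphereLocal_quart_zero hu, h _ v.2.1,
      Submodule.mem_orthogonal_singleton_iff_inner_right.1 v.2.2]
    simp

/-- Supplies the trivial kernel for the branch. Pairing with `u`, Euler's identity yields `3 Q(u)
⟨u,v⟩ = Q(u) ⟨u,v⟩`, so `v` is tangent because `Q(u) ≠ 0`. On tangent vectors the hypothesis says
that `v` lies in the kernel of the chart Hessian. -/
theorem eq_zero_of_cubicDeriv_eq (h : IsSphereNondegenerate J.quart F u) (hq : J.quart u ≠ 0)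
    {v : E} (hv : v ∈ F)
    (hd : ∀ e ∈ F, inner ℝ (J.cubicDeriv u v) e = J.quart u * inner ℝ v e) : v = 0 := by
  have hcrit := (isSphereCritical_quart_iff h.mem h.norm_eq).1 h.toIsSphereCritical
  have horth : inner ℝ u v = (0 : ℝ) := by
    have h1 := hd u h.mem
    rw [J.inner_cubicDeriv, J.cubicDeriv_self, inner_smul_right, real_inner_comm,
      hcrit v hv, real_inner_comm u v] at h1
    have h2 : J.quart u * inner ℝ u v = 0 := by linarith
    exact (mul_eq_zero.1 h2).resolve_left hq
  have := h.nondegenerate ⟨v, hv, Submodule.mem_orthogonal_singleton_iff_inner_right.2 horth⟩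
    fun v' => by
      rw [fderiv_fderiv_sphereLocal_quart_zero h.norm_eq, hd v' v'.2.1]
      simp; ring
  simpa using congrArg Subtype.val this

end GradientJet

end

/-! ### Symmetries of the derivatives of a gradient, and the quartic as a reduced potential -/

section

variable {E : Type*} [NormedAddCommGroup E] [InnerProductSpace ℝ E] [CompleteSpace E]
  {L : E → ℝ} {w : E}

theorem contDiffAt_gradient {n m : ℕ} (hL : ContDiffAt ℝ n L w) (hmn : m + 1 ≤ n) :
    ContDiffAt ℝ m (gradient L) w := by
  have h : ContDiffAt ℝ m (fderiv ℝ L) w := hL.fderiv_right (by exact_mod_cast hmn)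
  exact (InnerProductSpace.toDual ℝ E).symm.toContinuousLinearEquiv.contDiff.contDiffAt.comp w h

theorem fderiv_eq_innerSL_gradient : fderiv ℝ L = fun x => innerSL ℝ (gradient L x) := by
  ext x v
  simp

theorem inner_fderiv_gradient (hL : ContDiffAt ℝ 2 L w) (a b : E) :
    inner ℝ (fderiv ℝ (gradient L) w a) b = inner ℝ a (fderiv ℝ (gradient L) w b) := by
  have hg := ((contDiffAt_gradient (n := 2) (m := 1) hL le_rfl).differentiableAt
    (by simp)).hasFDerivAt
  have h2 : ∀ a b, fderiv ℝ (fderiv ℝ L) w a b = inner ℝ (fderiv ℝ (gradient L) w a) b := by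
    intro a b
    have h : HasFDerivAt (fderiv ℝ L) ((innerSL ℝ).comp (fderiv ℝ (gradient L) w)) w := by
      rw [fderiv_eq_innerSL_gradient]
      exact (innerSL ℝ).hasFDerivAt.comp w hg
    rw [h.fderiv]; simp
  rw [← h2, (hL.isSymmSndFDerivAt (by simp)).eq a b, h2, real_inner_comm]

/-- The Hessian is self-adjoint at every point near `w`; this identity is differentiated in the
direction `a`. One more differentiation gives the next lemma. -/
theorem inner_fderiv_fderiv_gradient (hL : ContDiffAt ℝ 3 L w) (a b c : E) :
    inner ℝ (fderiv ℝ (fderiv ℝ (gradient L)) w a b) c =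
      inner ℝ b (fderiv ℝ (fderiv ℝ (gradient L)) w a c) := by
  have hg : ContDiffAt ℝ 1 (fderiv ℝ (gradient L)) w :=
    (contDiffAt_gradient (n := 3) (m := 2) hL le_rfl).fderiv_right (by norm_num)
  have hd := (hg.differentiableAt (by simp)).hasFDerivAt
  have key : ∀ b, HasFDerivAt (fun x => fderiv ℝ (gradient L) x b)
      ((fderiv ℝ (fderiv ℝ (gradient L)) w).flip b) w := fun b => by
    refine (hd.clm_apply (hasFDerivAt_const b w)).congr_fderiv ?_
    ext v; simp
  have heq : (fun x => inner ℝ (fderiv ℝ (gradient L) x b) c) =ᶠ[𝓝 w]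
      fun x => inner ℝ b (fderiv ℝ (gradient L) x c) := by
    filter_upwards [hL.eventually (by simp)] with x hx
    exact inner_fderiv_gradient (hx.of_le (by norm_num)) b c
  have h := ((key b).inner ℝ (hasFDerivAt_const c w)).unique
    (((hasFDerivAt_const b w).inner ℝ (key c)).congr_of_eventuallyEq heq)
  simpa using DFunLike.congr_fun h a

theorem inner_fderiv_fderiv_fderiv_gradient (hL : ContDiffAt ℝ 4 L w) (a b c d : E) :
    inner ℝ (fderiv ℝ (fderiv ℝ (fderiv ℝ (gradient L))) w a b c) d =
      inner ℝ c (fderiv ℝ (fderiv ℝ (fderiv ℝ (gradient L))) w a b d) := by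
  have hg : ContDiffAt ℝ 1 (fderiv ℝ (fderiv ℝ (gradient L))) w :=
    ((contDiffAt_gradient (n := 4) (m := 3) hL le_rfl).fderiv_right (m := 2)
      (by norm_num)).fderiv_right (by norm_num)
  have hd := (hg.differentiableAt (by simp)).hasFDerivAt
  have key : ∀ c, HasFDerivAt (fun x => fderiv ℝ (fderiv ℝ (gradient L)) x b c)
      (((fderiv ℝ (fderiv ℝ (fderiv ℝ (gradient L))) w).flip b).flip c) w := fun c => by
    refine ((hd.clm_apply (hasFDerivAt_const b w)).clm_apply
      (hasFDerivAt_const c w)).congr_fderiv ?_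
    ext v; simp
  have heq : (fun x => inner ℝ (fderiv ℝ (fderiv ℝ (gradient L)) x b c) d) =ᶠ[𝓝 w]
      fun x => inner ℝ c (fderiv ℝ (fderiv ℝ (gradient L)) x b d) := by
    filter_upwards [hL.eventually (by simp)] with x hx
    exact inner_fderiv_fderiv_gradient (hx.of_le (by norm_num)) b c d
  have h := ((key c).inner ℝ (hasFDerivAt_const d w)).unique
    (((hasFDerivAt_const c w).inner ℝ (key d)).congr_of_eventuallyEq heq)
  simpa using DFunLike.congr_fun h a

/-- The jet of the gradient field of `L` at a point where the Hessian is invertible. -/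
def gradientJet (hL : ContDiffAt ℝ 4 L w) (hinv : (hess L w).IsInvertible) : GradientJet E where
  H := hinv.choose
  T := fderiv ℝ (fderiv ℝ (gradient L)) w
  K := fderiv ℝ (fderiv ℝ (fderiv ℝ (gradient L))) w
  inner_H a b := by
    have h : ∀ x, hinv.choose x = hess L w x := fun x => DFunLike.congr_fun hinv.choose_spec x
    rw [h, h]
    exact inner_fderiv_gradient (hL.of_le (by norm_num)) a b
  T_comm a b := ((contDiffAt_gradient (n := 4) (m := 3) hL le_rfl).isSymmSndFDerivAt
    (by norm_num)).eq a b
  inner_T := inner_fderiv_fderiv_gradient (hL.of_le (by norm_num))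
  K_comm_left a b c := by
    have h : ContDiffAt ℝ 2 (fderiv ℝ (gradient L)) w :=
      (contDiffAt_gradient (n := 4) (m := 3) hL le_rfl).fderiv_right (by norm_num)
    rw [(h.isSymmSndFDerivAt (by simp)).eq a b]
  K_comm_right := fderiv_fderiv_fderiv_apply_comm
    (contDiffAt_gradient (n := 4) (m := 3) hL le_rfl)
  inner_K := inner_fderiv_fderiv_fderiv_gradient hL

theorem gradientJet_H (hL : ContDiffAt ℝ 4 L w) (hinv : (hess L w).IsInvertible) :
    ((gradientJet hL hinv).H : E →L[ℝ] E) = fderiv ℝ (gradient L) w := hinv.choose_spec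

theorem iteratedFDeriv_three_apply {V F : Type*} [NormedAddCommGroup V] [NormedSpace ℝ V]
    [NormedAddCommGroup F] [NormedSpace ℝ F] (g : V → F) (x a : V) :
    iteratedFDeriv ℝ 3 g x (fun _ => a) = fderiv ℝ (fderiv ℝ (fderiv ℝ g)) x a a a := by
  rw [iteratedFDeriv_succ_apply_right]
  exact DFunLike.congr_fun (iteratedFDeriv_two_apply (𝕜 := ℝ) (fderiv ℝ g) x (Fin.init fun _ => a)) a

theorem iteratedFDeriv_four_eq_inner (hL : ContDiffAt ℝ 4 L w) (a : E) :
    iteratedFDeriv ℝ 4 L w (fun _ => a) =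
      inner ℝ (fderiv ℝ (fderiv ℝ (fderiv ℝ (gradient L))) w a a a) a := by
  rw [iteratedFDeriv_succ_apply_right, fderiv_eq_innerSL_gradient]
  have := (innerSL ℝ (E := E)).iteratedFDeriv_comp_left (i := 3) (n := 3)
    (contDiffAt_gradient (n := 4) (m := 3) hL le_rfl) le_rfl
  have h := DFunLike.congr_fun (DFunLike.congr_fun this (fun _ => a)) a
  refine h.trans ?_
  rw [ContinuousLinearMap.compContinuousMultilinearMap_coe, Function.comp_apply,
    iteratedFDeriv_three_apply, innerSL_apply_apply]

/-- The correction with `H⁻¹` comes from eliminating the midpoint: `⟨T(a, center a), a⟩ = ⟨center a,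
T(a,a)⟩`, and `center a = -½ H⁻¹ T(a,a)`. -/
theorem quartic_eq_quart (hL : ContDiffAt ℝ 4 L w) (hinv : (hess L w).IsInvertible) :
    quartic L w = (gradientJet hL hinv).quart := by
  ext a
  set J := gradientJet hL hinv with hJ
  have h3 : thirdVec L w a = J.T a a := iteratedFDeriv_two_apply (𝕜 := ℝ) (gradient L) w fun _ => a
  have hinvH : (hess L w).inverse = (J.H.symm : E →L[ℝ] E) := by
    rw [hess, ← gradientJet_H hL hinv, ContinuousLinearMap.inverse_equiv]
  rw [quartic, h3, hinvH, iteratedFDeriv_four_eq_inner hL, GradientJet.quart, GradientJet.cubic,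
    inner_add_left, GradientJet.center, map_smul, inner_smul_left, inner_smul_left,
    J.inner_T a a, real_inner_comm (J.T a _) a]
  change _ = _ + _ * inner ℝ (fderiv ℝ (fderiv ℝ (fderiv ℝ (gradient L))) w a a a) a
  simp
  ring

end

/-! ### Limits of the blown-up equations and of their derivatives -/

section

variable {E : Type*} [NormedAddCommGroup E] [InnerProductSpace ℝ E]

/-- `J` is the jet of the `C^3` vector field `g` at its zero `w`. -/
structure HasJet (g : E → E) (w : E) (J : GradientJet E) : Prop where
  contDiffAt : ContDiffAt ℝ 3 g w
  map_eq_zero : g w = 0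
  fderiv_eq : fderiv ℝ g w = (J.H : E →L[ℝ] E)
  fderiv_fderiv_eq : fderiv ℝ (fderiv ℝ g) w = J.T
  fderiv_fderiv_fderiv_eq : fderiv ℝ (fderiv ℝ (fderiv ℝ g)) w = J.K

theorem hasJet_gradientJet [CompleteSpace E] {L : E → ℝ} {w : E} (hL : ContDiffAt ℝ 4 L w)
    (hcrit : gradient L w = 0) (hinv : (hess L w).IsInvertible) :
    HasJet (gradient L) w (gradientJet hL hinv) :=
  ⟨contDiffAt_gradient (n := 4) (m := 3) hL le_rfl, hcrit, (gradientJet_H hL hinv).symm, rfl, rfl⟩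

theorem tendsto_inv_pow_smul_comp {ι F : Type*} [NormedAddCommGroup F] [NormedSpace ℝ F]
    {l : Filter ι} {f : E → F} {n : ℕ} (hf : f =o[𝓝 0] fun k => ‖k‖ ^ n) {r : ι → ℝ} {m : ι → E}
    {m₀ : E} (hr : Tendsto r l (𝓝 0)) (hm : Tendsto m l (𝓝 m₀)) :
    Tendsto (fun i => (r i ^ n)⁻¹ • f (r i • m i)) l (𝓝 0) := by
  have hk : Tendsto (fun i => r i • m i) l (𝓝 0) := by simpa using hr.smul hm
  have h1 := hf.comp_tendsto hk
  have h2 : (fun i => ‖r i • m i‖ ^ n) =O[l] fun i => r i ^ n := by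
    have hb : (fun i => r i • m i) =O[l] r := by
      simpa using (isBigO_refl r l).smul (hm.isBigO_one ℝ)
    exact hb.norm_left.pow n
  have h3 := h1.trans_isBigO h2
  have := (isBigO_refl (fun i => (r i ^ n)⁻¹) l).smul_isLittleO h3
  refine (isLittleO_one_iff ℝ).1 (this.trans_isBigO ?_)
  refine IsBigO.of_bound 1 (Eventually.of_forall fun i => ?_)
  -- Where `r i ^ n = 0` the product is `0` because `0⁻¹ = 0`, so no nonvanishing of `r` is needed.
  by_cases h : r i ^ n = 0 <;> simp [h]

/-- The rescaled sum `r⁻² (g (c + a) + g (c - a)) / 2`, with `c = w + r² b` and `a = r z`. -/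
def evenPart (g : E → E) (w : E) (r : ℝ) (b z : E) : E :=
  (r ^ 2)⁻¹ • (1 / 2 : ℝ) • (g (w + r • (r • b + z)) + g (w + r • (r • b - z)))

/-- The rescaled difference `r⁻³ ((g (c + a) - g (c - a)) / 2 - H a)`, with `c = w + r² b` and
`a = r z`. -/
def oddPart (g : E → E) (H : E →L[ℝ] E) (w : E) (r : ℝ) (b z : E) : E :=
  (r ^ 3)⁻¹ • ((1 / 2 : ℝ) • (g (w + r • (r • b + z)) - g (w + r • (r • b - z))) - r • H z)

section Limits

variable {g : E → E} {w : E} {J : GradientJet E} {ι : Type*} {l : Filter ι} {r : ι → ℝ}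
  {b z : ι → E} {b₀ z₀ : E}

/-- The linear terms `± r H z` cancel in the sum, so everything left is of order `r²`. -/
theorem HasJet.tendsto_evenPart (hg : HasJet g w J) (hr : Tendsto r l (𝓝 0))
    (hr0 : ∀ᶠ i in l, r i ≠ 0) (hb : Tendsto b l (𝓝 b₀)) (hz : Tendsto z l (𝓝 z₀)) :
    Tendsto (fun i => evenPart g w (r i) (b i) (z i)) l
      (𝓝 (J.H b₀ + (1 / 2 : ℝ) • J.T z₀ z₀)) := by
  have hT := taylor_two (hg.contDiffAt.of_le (by norm_num : (2 : WithTop ℕ∞) ≤ 3))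
  simp only [hg.map_eq_zero, hg.fderiv_eq, hg.fderiv_fderiv_eq, sub_zero,
    ContinuousLinearEquiv.coe_coe] at hT
  have hp : Tendsto (fun i => r i • b i + z i) l (𝓝 z₀) := by simpa using (hr.smul hb).add hz
  have hm : Tendsto (fun i => r i • b i - z i) l (𝓝 (-z₀)) := by simpa using (hr.smul hb).sub hz
  have h1 := tendsto_inv_pow_smul_comp hT hr hp
  have h2 := tendsto_inv_pow_smul_comp hT hr hm
  have hc : Continuous fun p : E × E × E =>
      J.H p.1 + (1 / 4 : ℝ) • (J.T p.2.1 p.2.1 + J.T p.2.2 p.2.2) := by fun_prop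
  have h3 := (hc.tendsto (b₀, z₀, -z₀)).comp (hb.prodMk_nhds (hp.prodMk_nhds hm))
  have h4 := h3.add ((h1.add h2).const_smul (1 / 2 : ℝ))
  have hlim : J.H b₀ + (1 / 4 : ℝ) • (J.T z₀ z₀ + J.T (-z₀) (-z₀)) + (1 / 2 : ℝ) • ((0 : E) + 0)
      = J.H b₀ + (1 / 2 : ℝ) • J.T z₀ z₀ := by
    simp only [map_neg, neg_apply, neg_neg]; module
  dsimp only at h4
  rw [hlim] at h4
  refine h4.congr' ?_
  filter_upwards [hr0] with i hi
  simp only [Function.comp_apply, evenPart, map_add, map_sub, map_smul, add_apply, sub_apply,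
    smul_apply]
  match_scalars <;> field_simp <;> ring

/-- In the difference the pure `T(z,z)` terms cancel; the mixed term `T(z,b)` and the cubic term
both appear at order `r³`, once `r H z` is subtracted. -/
theorem HasJet.tendsto_oddPart (hg : HasJet g w J) (hr : Tendsto r l (𝓝 0))
    (hr0 : ∀ᶠ i in l, r i ≠ 0) (hb : Tendsto b l (𝓝 b₀)) (hz : Tendsto z l (𝓝 z₀)) :
    Tendsto (fun i => oddPart g J.H w (r i) (b i) (z i)) l
      (𝓝 (J.T z₀ b₀ + (1 / 6 : ℝ) • J.K z₀ z₀ z₀)) := by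
  have hT := taylor_three hg.contDiffAt
  simp only [hg.map_eq_zero, hg.fderiv_eq, hg.fderiv_fderiv_eq, hg.fderiv_fderiv_fderiv_eq,
    sub_zero, ContinuousLinearEquiv.coe_coe] at hT
  have hp : Tendsto (fun i => r i • b i + z i) l (𝓝 z₀) := by simpa using (hr.smul hb).add hz
  have hm : Tendsto (fun i => r i • b i - z i) l (𝓝 (-z₀)) := by simpa using (hr.smul hb).sub hz
  have h1 := tendsto_inv_pow_smul_comp hT hr hp
  have h2 := tendsto_inv_pow_smul_comp hT hr hm
  have hc : Continuous fun p : (E × E) × E × E => J.T p.1.1 p.1.2 +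
      (1 / 12 : ℝ) • (J.K p.2.1 p.2.1 p.2.1 - J.K p.2.2 p.2.2 p.2.2) := by fun_prop
  have h3 := (hc.tendsto ((z₀, b₀), z₀, -z₀)).comp
    ((hz.prodMk_nhds hb).prodMk_nhds (hp.prodMk_nhds hm))
  have h4 := h3.add ((h1.sub h2).const_smul (1 / 2 : ℝ))
  have hlim : J.T z₀ b₀ + (1 / 12 : ℝ) • (J.K z₀ z₀ z₀ - J.K (-z₀) (-z₀) (-z₀)) +
      (1 / 2 : ℝ) • ((0 : E) - 0) = J.T z₀ b₀ + (1 / 6 : ℝ) • J.K z₀ z₀ z₀ := by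
    simp only [map_neg, neg_apply, neg_neg]; module
  dsimp only at h4
  rw [hlim] at h4
  refine h4.congr' ?_
  filter_upwards [hr0] with i hi
  have hK : ∀ x : E, J.K (r i • x) (r i • x) (r i • x) = r i ^ 3 • J.K x x x := fun x => by
    simp only [map_smul, smul_apply, smul_smul]; ring_nf
  simp only [Function.comp_apply, oddPart, hK]
  generalize J.K (r i • b i + z i) (r i • b i + z i) (r i • b i + z i) = k₁
  generalize J.K (r i • b i - z i) (r i • b i - z i) (r i • b i - z i) = k₂
  simp only [map_add, map_sub, map_smul, add_apply, sub_apply, smul_apply, J.T_comm (b i) (z i),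
    ContinuousLinearEquiv.coe_coe]
  match_scalars <;> field_simp <;> ring

/-- This limit and the next two are those of the blocks `S`, `D`, `M` of `branchDeriv`: `S` and `D`
are the partial derivatives of `evenPart` in `b` and `z`, `D` and `M` those of `oddPart`. -/
theorem HasJet.tendsto_fderiv_add (hg : HasJet g w J) (hr : Tendsto r l (𝓝 0))
    (hb : Tendsto b l (𝓝 b₀)) (hz : Tendsto z l (𝓝 z₀)) :
    Tendsto (fun i => (1 / 2 : ℝ) • (fderiv ℝ g (w + r i • (r i • b i + z i)) +
      fderiv ℝ g (w + r i • (r i • b i - z i)))) l (𝓝 (J.H : E →L[ℝ] E)) := by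
  have hcont : ContinuousAt (fderiv ℝ g) w :=
    (hg.contDiffAt.fderiv_right (m := 2) (by norm_num)).continuousAt
  have hp : Tendsto (fun i => w + r i • (r i • b i + z i)) l (𝓝 w) := by
    simpa using (hr.smul ((hr.smul hb).add hz)).const_add w
  have hm : Tendsto (fun i => w + r i • (r i • b i - z i)) l (𝓝 w) := by
    simpa using (hr.smul ((hr.smul hb).sub hz)).const_add w
  have := ((hcont.tendsto.comp hp).add (hcont.tendsto.comp hm)).const_smul (1 / 2 : ℝ)
  have hlim : (1 / 2 : ℝ) • ((J.H : E →L[ℝ] E) + J.H) = J.H := by module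
  rwa [hg.fderiv_eq, hlim] at this

theorem HasJet.tendsto_fderiv_sub (hg : HasJet g w J) (hr : Tendsto r l (𝓝 0))
    (hr0 : ∀ᶠ i in l, r i ≠ 0) (hb : Tendsto b l (𝓝 b₀)) (hz : Tendsto z l (𝓝 z₀)) :
    Tendsto (fun i => (r i)⁻¹ • (1 / 2 : ℝ) • (fderiv ℝ g (w + r i • (r i • b i + z i)) -
      fderiv ℝ g (w + r i • (r i • b i - z i)))) l (𝓝 (J.T z₀)) := by
  have hf : ContDiffAt ℝ 2 (fderiv ℝ g) w := hg.contDiffAt.fderiv_right (by norm_num)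
  have hT := taylor_one (hf.differentiableAt (by simp))
  simp only [hg.fderiv_eq, hg.fderiv_fderiv_eq] at hT
  have hp : Tendsto (fun i => r i • b i + z i) l (𝓝 z₀) := by simpa using (hr.smul hb).add hz
  have hm : Tendsto (fun i => r i • b i - z i) l (𝓝 (-z₀)) := by simpa using (hr.smul hb).sub hz
  have h1 := tendsto_inv_pow_smul_comp hT hr hp
  have h2 := tendsto_inv_pow_smul_comp hT hr hm
  have h3 := ((J.T.continuous.tendsto z₀).comp hz).add ((h1.sub h2).const_smul (1 / 2 : ℝ))
  rw [sub_zero, smul_zero, add_zero] at h3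
  refine h3.congr' ?_
  filter_upwards [hr0] with i hi
  simp only [Function.comp_apply, map_add, map_sub, map_smul, pow_one]
  match_scalars <;> field_simp <;> ring

theorem HasJet.tendsto_fderiv_add_sub (hg : HasJet g w J) (hr : Tendsto r l (𝓝 0))
    (hr0 : ∀ᶠ i in l, r i ≠ 0) (hb : Tendsto b l (𝓝 b₀)) (hz : Tendsto z l (𝓝 z₀)) :
    Tendsto (fun i => (r i ^ 2)⁻¹ • ((1 / 2 : ℝ) • (fderiv ℝ g (w + r i • (r i • b i + z i)) +
      fderiv ℝ g (w + r i • (r i • b i - z i))) - (J.H : E →L[ℝ] E))) l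
      (𝓝 (J.T b₀ + (1 / 2 : ℝ) • J.K z₀ z₀)) := by
  have hf : ContDiffAt ℝ 2 (fderiv ℝ g) w := hg.contDiffAt.fderiv_right (by norm_num)
  have hT := taylor_two hf
  simp only [hg.fderiv_eq, hg.fderiv_fderiv_eq, hg.fderiv_fderiv_fderiv_eq] at hT
  have hp : Tendsto (fun i => r i • b i + z i) l (𝓝 z₀) := by simpa using (hr.smul hb).add hz
  have hm : Tendsto (fun i => r i • b i - z i) l (𝓝 (-z₀)) := by simpa using (hr.smul hb).sub hz
  have h1 := tendsto_inv_pow_smul_comp hT hr hp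
  have h2 := tendsto_inv_pow_smul_comp hT hr hm
  have hc : Continuous fun p : E × E × E =>
      J.T p.1 + (1 / 4 : ℝ) • (J.K p.2.1 p.2.1 + J.K p.2.2 p.2.2) := by fun_prop
  have h3 := (hc.tendsto (b₀, z₀, -z₀)).comp (hb.prodMk_nhds (hp.prodMk_nhds hm))
  have h4 := h3.add ((h1.add h2).const_smul (1 / 2 : ℝ))
  have hlim : J.T b₀ + (1 / 4 : ℝ) • (J.K z₀ z₀ + J.K (-z₀) (-z₀)) +
      (1 / 2 : ℝ) • ((0 : E →L[ℝ] E) + 0) = J.T b₀ + (1 / 2 : ℝ) • J.K z₀ z₀ := by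
    simp only [map_neg, neg_apply, neg_neg]; module
  dsimp only at h4
  rw [hlim] at h4
  refine h4.congr' ?_
  filter_upwards [hr0] with i hi
  simp only [Function.comp_apply, map_add, map_sub, map_smul, add_apply, sub_apply,
    smul_apply]
  match_scalars <;> field_simp <;> ring

end Limits

end

/-! ### The branch in blown-up coordinates -/

section

variable {E : Type*} [NormedAddCommGroup E] [InnerProductSpace ℝ E]

section Derivatives

variable {g : E → E} {w : E} {r : ℝ} {b z : E}

theorem hasFDerivAt_comp_smul_add (hp : DifferentiableAt ℝ g (w + r • (r • b + z))) :
    HasFDerivAt (fun ξ : E × E => g (w + r • (r • ξ.1 + ξ.2)))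
      ((fderiv ℝ g (w + r • (r • b + z))).comp (r • (r • ContinuousLinearMap.fst ℝ E E +
        ContinuousLinearMap.snd ℝ E E))) (b, z) :=
  HasFDerivAt.comp (b, z) (f := fun ξ : E × E => w + r • (r • ξ.1 + ξ.2)) hp.hasFDerivAt
    (((hasFDerivAt_fst.const_smul r).add hasFDerivAt_snd).const_smul r |>.const_add w)

theorem hasFDerivAt_comp_smul_sub (hm : DifferentiableAt ℝ g (w + r • (r • b - z))) :
    HasFDerivAt (fun ξ : E × E => g (w + r • (r • ξ.1 - ξ.2)))
      ((fderiv ℝ g (w + r • (r • b - z))).comp (r • (r • ContinuousLinearMap.fst ℝ E E -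
        ContinuousLinearMap.snd ℝ E E))) (b, z) :=
  HasFDerivAt.comp (b, z) (f := fun ξ : E × E => w + r • (r • ξ.1 - ξ.2)) hm.hasFDerivAt
    (((hasFDerivAt_fst.const_smul r).sub hasFDerivAt_snd).const_smul r |>.const_add w)

theorem hasFDerivAt_evenPart (hr : r ≠ 0) (hp : DifferentiableAt ℝ g (w + r • (r • b + z)))
    (hm : DifferentiableAt ℝ g (w + r • (r • b - z))) :
    HasFDerivAt (fun ξ : E × E => evenPart g w r ξ.1 ξ.2)
      (((1 / 2 : ℝ) • (fderiv ℝ g (w + r • (r • b + z)) +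
          fderiv ℝ g (w + r • (r • b - z)))).comp (ContinuousLinearMap.fst ℝ E E) +
        (r⁻¹ • (1 / 2 : ℝ) • (fderiv ℝ g (w + r • (r • b + z)) -
          fderiv ℝ g (w + r • (r • b - z)))).comp (ContinuousLinearMap.snd ℝ E E)) (b, z) := by
  have h := (((hasFDerivAt_comp_smul_add hp).add (hasFDerivAt_comp_smul_sub hm)).const_smul
    (1 / 2 : ℝ)).const_smul (r ^ 2)⁻¹
  refine h.congr_fderiv ?_
  refine ContinuousLinearMap.ext fun v => ?_
  simp only [add_apply, sub_apply, smul_apply, ContinuousLinearMap.comp_apply,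
    ContinuousLinearMap.coe_fst', ContinuousLinearMap.coe_snd', map_add, map_sub, map_smul]
  match_scalars <;> field_simp

theorem hasFDerivAt_oddPart (H : E →L[ℝ] E) (hr : r ≠ 0)
    (hp : DifferentiableAt ℝ g (w + r • (r • b + z)))
    (hm : DifferentiableAt ℝ g (w + r • (r • b - z))) :
    HasFDerivAt (fun ξ : E × E => oddPart g H w r ξ.1 ξ.2)
      ((r⁻¹ • (1 / 2 : ℝ) • (fderiv ℝ g (w + r • (r • b + z)) -
          fderiv ℝ g (w + r • (r • b - z)))).comp (ContinuousLinearMap.fst ℝ E E) +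
        ((r ^ 2)⁻¹ • ((1 / 2 : ℝ) • (fderiv ℝ g (w + r • (r • b + z)) +
          fderiv ℝ g (w + r • (r • b - z))) - H)).comp (ContinuousLinearMap.snd ℝ E E))
      (b, z) := by
  have h := ((((hasFDerivAt_comp_smul_add hp).sub (hasFDerivAt_comp_smul_sub hm)).const_smul
    (1 / 2 : ℝ)).sub ((H.hasFDerivAt.comp (b, z) hasFDerivAt_snd).const_smul r)).const_smul
      (r ^ 3)⁻¹
  refine h.congr_fderiv ?_
  refine ContinuousLinearMap.ext fun v => ?_
  simp only [add_apply, sub_apply, smul_apply, ContinuousLinearMap.comp_apply,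
    ContinuousLinearMap.coe_fst', ContinuousLinearMap.coe_snd', map_add, map_sub, map_smul]
  match_scalars <;> field_simp

end Derivatives

section Branch

variable [FiniteDimensional ℝ E] {g : E → E} {w : E} {J : GradientJet E} {F : Submodule ℝ E}
  {μc σ : ℝ} {z₀ : E}

/-- The rescaled equations for a period-two orbit `w + r² b ∓ r z` at step size `2 / (μc + σ r²)`,
the second one multiplied by an invertible operator to make it regular at `r = 0`. -/
def branchMap (g : E → E) (H : E →L[ℝ] E) (w : E) (F : Submodule ℝ E) (μc σ r : ℝ) (ξ : E × E) :
    E × E :=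
  (evenPart g w r ξ.1 ξ.2,
    H ξ.2 - μc • ξ.2 + (F.starProjection + r ^ 2 • (ContinuousLinearMap.id ℝ E - F.starProjection))
      (oddPart g H w r ξ.1 ξ.2 - σ • ξ.2))

/-- The derivative of `branchMap`, as a function of the derivatives of its ingredients. -/
def branchDeriv (H : E →L[ℝ] E) (F : Submodule ℝ E) (μc σ r : ℝ) (S D M : E →L[ℝ] E) :
    E × E →L[ℝ] E × E :=
  (ContinuousLinearMap.inl ℝ E E).comp (S.comp (ContinuousLinearMap.fst ℝ E E) +
      D.comp (ContinuousLinearMap.snd ℝ E E)) +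
    (ContinuousLinearMap.inr ℝ E E).comp ((H - μc • ContinuousLinearMap.id ℝ E).comp
        (ContinuousLinearMap.snd ℝ E E) +
      (F.starProjection + r ^ 2 • (ContinuousLinearMap.id ℝ E - F.starProjection)).comp
        (D.comp (ContinuousLinearMap.fst ℝ E E) + M.comp (ContinuousLinearMap.snd ℝ E E) -
          σ • ContinuousLinearMap.snd ℝ E E))

theorem branchMap_eq_zero_iff (hF : ∀ e, e ∈ F ↔ J.H e = μc • e) {r : ℝ} (hr : r ≠ 0)
    (b z : E) : branchMap g J.H w F μc σ r (b, z) = 0 ↔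
      g (w + r • (r • b + z)) = (r * (μc + σ * r ^ 2)) • z ∧
      g (w + r • (r • b - z)) = -((r * (μc + σ * r ^ 2)) • z) := by
  set P := F.starProjection with hP
  set V := oddPart g J.H w r b z - σ • z with hV
  have hPH : P (J.H z - μc • z) = 0 := by
    rw [hP, Submodule.starProjection_apply_eq_zero_iff, Submodule.mem_orthogonal]
    intro e he
    rw [inner_sub_right, ← J.inner_H, (hF e).1 he, inner_smul_left, inner_smul_right]
    simp
  have hPP : ∀ x, P (P x) = P x := fun x => by
    rw [hP, Submodule.starProjection_eq_self_iff]
    exact Submodule.starProjection_apply_mem F x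
  -- Since `H - μc` is self-adjoint with kernel `F`, its range is orthogonal to `F`. Applying `P` to
  -- either equation therefore gives `P V = 0`, and then both read the same.
  have h2 : (J.H z - μc • z + (P + r ^ 2 • (ContinuousLinearMap.id ℝ E - P)) V = 0) ↔
      J.H z - μc • z + r ^ 2 • V = 0 := by
    constructor
    · intro h
      have h1 := congrArg P h
      simp only [add_apply, smul_apply, sub_apply, map_add, map_smul, map_sub, hPP, hPH,
        ContinuousLinearMap.id_apply, map_zero, sub_self, smul_zero, zero_add, add_zero] at h1
      simpa [h1] using h
    · intro h
      have h1 := congrArg P h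
      rw [map_add, hPH, map_smul, map_zero, zero_add, smul_eq_zero] at h1
      have h1 := h1.resolve_left (pow_ne_zero 2 hr)
      simpa [h1] using h
  have h3 : r • (J.H z - μc • z + r ^ 2 • V) = (1 / 2 : ℝ) • (g (w + r • (r • b + z)) -
      g (w + r • (r • b - z))) - (r * (μc + σ * r ^ 2)) • z := by
    rw [hV, oddPart, ContinuousLinearEquiv.coe_coe]
    match_scalars <;> field_simp <;> ring
  have h4 : evenPart g w r b z = 0 ↔
      g (w + r • (r • b + z)) + g (w + r • (r • b - z)) = 0 := by
    rw [evenPart, smul_eq_zero_iff_right (inv_ne_zero (pow_ne_zero 2 hr)),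
      smul_eq_zero_iff_right (by norm_num)]
  rw [branchMap, Prod.mk_eq_zero]
  refine (and_congr h4 h2).trans ?_
  rw [← smul_eq_zero_iff_right hr (m := J.H z - μc • z + r ^ 2 • V), h3]
  generalize g (w + r • (r • b + z)) = p
  generalize g (w + r • (r • b - z)) = m
  generalize (r * (μc + σ * r ^ 2)) • z = y
  constructor
  · rintro ⟨h, h'⟩
    have hm : m = -p := by rw [← add_eq_zero_iff_eq_neg', h]
    subst hm
    have : p = y := by
      rw [← sub_eq_zero, ← h']; module
    exact ⟨this, by rw [this]⟩
  · rintro ⟨rfl, rfl⟩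
    exact ⟨by simp, by module⟩

/-- The first component forces `β = -H⁻¹ T(z₀, v)`. The second splits along `F` and its complement:
the complement gives `v ∈ F`, and the `F`-part, after inserting `β`, says `cubicDeriv z₀ v - σ v ⟂
F`. -/
theorem branchDeriv_injective (hF : ∀ e, e ∈ F ↔ J.H e = μc • e)
    (hnd : ∀ v ∈ F, (∀ e ∈ F, inner ℝ (J.cubicDeriv z₀ v) e = σ * inner ℝ v e) → v = 0) :
    Function.Injective (branchDeriv J.H F μc σ 0 J.H (J.T z₀)
      (J.T (J.center z₀) + (1 / 2 : ℝ) • J.K z₀ z₀)) := by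
  refine (injective_iff_map_eq_zero _).2 ?_
  rintro ⟨β, v⟩ h
  set P := F.starProjection with hP
  simp only [branchDeriv, add_apply, ContinuousLinearMap.comp_apply, ContinuousLinearMap.inl_apply,
    ContinuousLinearMap.inr_apply, ContinuousLinearMap.coe_fst', ContinuousLinearMap.coe_snd',
    sub_apply, smul_apply, ContinuousLinearMap.id_apply, Prod.mk_add_mk, Prod.mk_eq_zero,
    add_zero, zero_add, zero_pow two_ne_zero, zero_smul, ContinuousLinearEquiv.coe_coe, ← hP] at h
  obtain ⟨h1, h2⟩ := h
  have hPH : P (J.H v - μc • v) = 0 := by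
    rw [hP, Submodule.starProjection_apply_eq_zero_iff, Submodule.mem_orthogonal]
    intro e he
    rw [inner_sub_right, ← J.inner_H, (hF e).1 he, inner_smul_left, inner_smul_right]
    simp
  have hPP : ∀ x, P (P x) = P x := fun x => by
    rw [hP, Submodule.starProjection_eq_self_iff]
    exact Submodule.starProjection_apply_mem F x
  have h3 := congrArg P h2
  rw [map_add, hPH, hPP, map_zero, zero_add] at h3
  rw [h3, add_zero, sub_eq_zero] at h2
  have hβ : β = -J.H.symm (J.T z₀ v) := by
    rw [← map_neg, ContinuousLinearEquiv.eq_symm_apply]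
    exact eq_neg_of_add_eq_zero_left h1
  have hv : v = 0 := by
    refine hnd v ((hF v).2 h2) fun e he => ?_
    rw [hP, Submodule.starProjection_apply_eq_zero_iff, Submodule.mem_orthogonal'] at h3
    have h4 := h3 e he
    rw [inner_sub_left, inner_smul_left, sub_eq_zero] at h4
    rw [J.cubicDeriv_apply]
    refine Eq.trans ?_ h4
    rw [hβ, J.T_comm v, map_neg]
    congr 1
    module
  simp [hβ, hv]

theorem hasFDerivAt_branchMap (H : E →L[ℝ] E) {r : ℝ} {b z : E} (hr : r ≠ 0)
    (hp : DifferentiableAt ℝ g (w + r • (r • b + z)))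
    (hm : DifferentiableAt ℝ g (w + r • (r • b - z))) :
    HasFDerivAt (branchMap g H w F μc σ r) (branchDeriv H F μc σ r
      ((1 / 2 : ℝ) • (fderiv ℝ g (w + r • (r • b + z)) + fderiv ℝ g (w + r • (r • b - z))))
      (r⁻¹ • (1 / 2 : ℝ) • (fderiv ℝ g (w + r • (r • b + z)) - fderiv ℝ g (w + r • (r • b - z))))
      ((r ^ 2)⁻¹ • ((1 / 2 : ℝ) • (fderiv ℝ g (w + r • (r • b + z)) +
          fderiv ℝ g (w + r • (r • b - z))) - H))) (b, z) := by
  have he := hasFDerivAt_evenPart hr hp hm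
  have ho := hasFDerivAt_oddPart H hr hp hm
  have hs : HasFDerivAt (fun ξ : E × E => ξ.2) (ContinuousLinearMap.snd ℝ E E) (b, z) :=
    hasFDerivAt_snd
  have h2 := ((H.hasFDerivAt.comp (b, z) hs).sub (hs.const_smul μc)).add
    ((F.starProjection + r ^ 2 • (ContinuousLinearMap.id ℝ E -
      F.starProjection)).hasFDerivAt.comp (b, z) (ho.sub (hs.const_smul σ)))
  refine (he.prodMk h2).congr_fderiv ?_
  refine ContinuousLinearMap.ext fun v => ?_
  simp [branchDeriv]

theorem continuousAt_branchMap (H : E →L[ℝ] E) {r : ℝ} {b z : E} (hr : r ≠ 0)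
    (hp : ContinuousAt g (w + r • (r • b + z))) (hm : ContinuousAt g (w + r • (r • b - z))) :
    ContinuousAt (fun r => branchMap g H w F μc σ r (b, z)) r := by
  have c1 : ContinuousAt (fun s : ℝ => g (w + s • (s • b + z))) r :=
    ContinuousAt.comp (f := fun s : ℝ => w + s • (s • b + z)) hp (by fun_prop)
  have c2 : ContinuousAt (fun s : ℝ => g (w + s • (s • b - z))) r :=
    ContinuousAt.comp (f := fun s : ℝ => w + s • (s • b - z)) hm (by fun_prop)
  have h2 : r ^ 2 ≠ 0 := pow_ne_zero 2 hr
  have h3 : r ^ 3 ≠ 0 := pow_ne_zero 3 hr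
  unfold branchMap evenPart oddPart
  fun_prop (disch := assumption)

theorem tendsto_clm_comp {ι V W X : Type*} [NormedAddCommGroup V] [NormedSpace ℝ V]
    [NormedAddCommGroup W] [NormedSpace ℝ W] [NormedAddCommGroup X] [NormedSpace ℝ X]
    {l : Filter ι} {A : ι → W →L[ℝ] X} {B : ι → V →L[ℝ] W} {A₀ : W →L[ℝ] X} {B₀ : V →L[ℝ] W}
    (hA : Tendsto A l (𝓝 A₀)) (hB : Tendsto B l (𝓝 B₀)) :
    Tendsto (fun i => (A i).comp (B i)) l (𝓝 (A₀.comp B₀)) :=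
  ((continuous_fst.clm_comp continuous_snd).tendsto (A₀, B₀)).comp (hA.prodMk_nhds hB)

theorem tendsto_branchDeriv (H : E →L[ℝ] E) {ι : Type*} {l : Filter ι} {r : ι → ℝ}
    {S D M : ι → E →L[ℝ] E} {r₀ : ℝ} {S₀ D₀ M₀ : E →L[ℝ] E} (hr : Tendsto r l (𝓝 r₀))
    (hS : Tendsto S l (𝓝 S₀)) (hD : Tendsto D l (𝓝 D₀)) (hM : Tendsto M l (𝓝 M₀)) :
    Tendsto (fun i => branchDeriv H F μc σ (r i) (S i) (D i) (M i)) l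
      (𝓝 (branchDeriv H F μc σ r₀ S₀ D₀ M₀)) := by
  have hQ : Tendsto (fun i => F.starProjection + r i ^ 2 • (ContinuousLinearMap.id ℝ E -
      F.starProjection)) l (𝓝 (F.starProjection + r₀ ^ 2 • (ContinuousLinearMap.id ℝ E -
      F.starProjection))) := ((hr.pow 2).smul_const _).const_add _
  have h1 := (tendsto_clm_comp hS (tendsto_const_nhds (x := ContinuousLinearMap.fst ℝ E E))).add
    (tendsto_clm_comp hD (tendsto_const_nhds (x := ContinuousLinearMap.snd ℝ E E)))
  have h2 := ((tendsto_clm_comp hD (tendsto_const_nhds (x := ContinuousLinearMap.fst ℝ E E))).add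
    (tendsto_clm_comp hM (tendsto_const_nhds (x := ContinuousLinearMap.snd ℝ E E)))).sub_const (σ • ContinuousLinearMap.snd ℝ E E)
  have h3 := (tendsto_clm_comp hQ h2).const_add ((H - μc • ContinuousLinearMap.id ℝ E).comp
        (ContinuousLinearMap.snd ℝ E E))
  exact (tendsto_clm_comp (tendsto_const_nhds (x := ContinuousLinearMap.inl ℝ E E)) h1).add
    (tendsto_clm_comp (tendsto_const_nhds (x := ContinuousLinearMap.inr ℝ E E)) h3)

/-- The point `(center z₀, z₀)` solves the limiting system: `H_center` treats the first component,
`z₀ ∈ F` removes `H z₀ - μc z₀`, and the multiplier equation removes the projected cubic term. -/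
theorem HasJet.tendsto_branchMap (hg : HasJet g w J) (hF : ∀ e, e ∈ F ↔ J.H e = μc • e)
    (hz₀F : z₀ ∈ F) (hcrit : ∀ e ∈ F, inner ℝ (J.cubic z₀) e = σ * inner ℝ z₀ e) :
    Tendsto (fun s => branchMap g J.H w F μc σ s (J.center z₀, z₀)) (𝓝[>] 0) (𝓝 0) := by
  have hr' : Tendsto (fun s : ℝ => s) (𝓝[>] 0) (𝓝 0) := nhdsWithin_le_nhds
  have hr0' : ∀ᶠ s : ℝ in 𝓝[>] 0, s ≠ 0 :=
    eventually_mem_nhdsWithin.mono fun x (hx : 0 < x) => hx.ne'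
  have he := hg.tendsto_evenPart hr' hr0' (tendsto_const_nhds (x := J.center z₀))
    (tendsto_const_nhds (x := z₀))
  have ho := hg.tendsto_oddPart hr' hr0' (tendsto_const_nhds (x := J.center z₀))
    (tendsto_const_nhds (x := z₀))
  rw [J.H_center] at he
  have hΦ : Continuous fun q : ℝ × E => J.H z₀ - μc • z₀ + (F.starProjection +
      q.1 ^ 2 • (ContinuousLinearMap.id ℝ E - F.starProjection)) (q.2 - σ • z₀) := by
    fun_prop
  have h2 := (hΦ.tendsto (0, _)).comp (hr'.prodMk_nhds ho)
  have hproj : F.starProjection (J.cubic z₀ - σ • z₀) = 0 := by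
    rw [Submodule.starProjection_apply_eq_zero_iff, Submodule.mem_orthogonal']
    intro e he
    rw [inner_sub_left, hcrit e he, inner_smul_left]
    simp
  have hval : J.H z₀ - μc • z₀ + (F.starProjection + (0 : ℝ) ^ 2 • (ContinuousLinearMap.id ℝ E -
      F.starProjection)) (J.T z₀ (J.center z₀) + (1 / 6 : ℝ) • J.K z₀ z₀ z₀ - σ • z₀) = 0 := by
    have : J.T z₀ (J.center z₀) + (1 / 6 : ℝ) • J.K z₀ z₀ z₀ = J.cubic z₀ := rfl
    rw [this, (hF z₀).1 hz₀F]
    simp [hproj]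
  dsimp only at h2
  rw [hval] at h2
  exact he.prodMk_nhds h2

theorem HasJet.exists_branch (hg : HasJet g w J) (hF : ∀ e, e ∈ F ↔ J.H e = μc • e)
    (hz₀ : z₀ ≠ 0) (hz₀F : z₀ ∈ F) (hcrit : ∀ e ∈ F, inner ℝ (J.cubic z₀) e = σ * inner ℝ z₀ e)
    (hnd : ∀ v ∈ F, (∀ e ∈ F, inner ℝ (J.cubicDeriv z₀ v) e = σ * inner ℝ v e) → v = 0) :
    ∃ (ζ : ℝ → E × E) (s₀ ρ : ℝ), 0 < s₀ ∧ 0 < ρ ∧ ContinuousOn ζ (Set.Ioo 0 s₀) ∧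
      Tendsto ζ (𝓝[>] 0) (𝓝 (J.center z₀, z₀)) ∧
      (∀ s ∈ Set.Ioo 0 s₀,
        g (w + s • (s • (ζ s).1 + (ζ s).2)) = (s * (μc + σ * s ^ 2)) • (ζ s).2 ∧
        g (w + s • (s • (ζ s).1 - (ζ s).2)) = -((s * (μc + σ * s ^ 2)) • (ζ s).2)) ∧
      ∀ s ∈ Set.Ioo 0 s₀, ∀ ξ ∈ Metric.closedBall (J.center z₀, z₀) ρ,
        g (w + s • (s • ξ.1 + ξ.2)) = (s * (μc + σ * s ^ 2)) • ξ.2 →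
        g (w + s • (s • ξ.1 - ξ.2)) = -((s * (μc + σ * s ^ 2)) • ξ.2) → ξ = ζ s := by
  have : Nontrivial E := ⟨z₀, 0, hz₀⟩
  have := FiniteDimensional.complete ℝ E
  set ξ₀ : E × E := (J.center z₀, z₀) with hξ₀
  set l : Filter (ℝ × E × E) := 𝓝[>] 0 ×ˢ 𝓝 ξ₀ with hl
  have hr : Tendsto (fun p : ℝ × E × E => p.1) l (𝓝 0) :=
    tendsto_fst.mono_right nhdsWithin_le_nhds
  have hr0 : ∀ᶠ p : ℝ × E × E in l, p.1 ≠ 0 :=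
    tendsto_fst.eventually (eventually_mem_nhdsWithin.mono fun x (hx : 0 < x) => hx.ne')
  have hξ : Tendsto (fun p : ℝ × E × E => p.2) l (𝓝 ξ₀) := tendsto_snd
  have hb : Tendsto (fun p : ℝ × E × E => p.2.1) l (𝓝 (J.center z₀)) :=
    (continuous_fst.tendsto ξ₀).comp hξ
  have hz : Tendsto (fun p : ℝ × E × E => p.2.2) l (𝓝 z₀) :=
    (continuous_snd.tendsto ξ₀).comp hξ
  have hp : Tendsto (fun p : ℝ × E × E => w + p.1 • (p.1 • p.2.1 + p.2.2)) l (𝓝 w) := by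
    simpa using (hr.smul ((hr.smul hb).add hz)).const_add w
  have hm : Tendsto (fun p : ℝ × E × E => w + p.1 • (p.1 • p.2.1 - p.2.2)) l (𝓝 w) := by
    simpa using (hr.smul ((hr.smul hb).sub hz)).const_add w
  have hdiff : ∀ᶠ x in 𝓝 w, DifferentiableAt ℝ g x :=
    (hg.contDiffAt.eventually (by simp)).mono fun x hx => hx.differentiableAt (by simp)
  obtain ⟨A, hA⟩ : ∃ A : (E × E) ≃L[ℝ] (E × E), (A : E × E →L[ℝ] E × E) =
      branchDeriv J.H F μc σ 0 J.H (J.T z₀) (J.T (J.center z₀) + (1 / 2 : ℝ) • J.K z₀ z₀) := by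
    refine ⟨(LinearEquiv.ofInjectiveEndo _
      (branchDeriv_injective hF hnd)).toContinuousLinearEquiv, ?_⟩
    ext v <;> rfl
  have key := exists_continuousOn_zero_of_tendsto_fderiv (F := branchMap g J.H w F μc σ)
      (F' := fun r ξ => branchDeriv J.H F μc σ r
      ((1 / 2 : ℝ) • (fderiv ℝ g (w + r • (r • ξ.1 + ξ.2)) +
        fderiv ℝ g (w + r • (r • ξ.1 - ξ.2))))
      (r⁻¹ • (1 / 2 : ℝ) • (fderiv ℝ g (w + r • (r • ξ.1 + ξ.2)) -
        fderiv ℝ g (w + r • (r • ξ.1 - ξ.2))))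
      ((r ^ 2)⁻¹ • ((1 / 2 : ℝ) • (fderiv ℝ g (w + r • (r • ξ.1 + ξ.2)) +
          fderiv ℝ g (w + r • (r • ξ.1 - ξ.2))) - J.H))) A (ξ₀ := ξ₀)
  specialize key (by
    filter_upwards [hr0, hp.eventually hdiff, hm.eventually hdiff] with p h0 h1 h2
    exact hasFDerivAt_branchMap _ h0 h1 h2)
  specialize key (by
    filter_upwards [hr0, hp.eventually hdiff, hm.eventually hdiff] with p h0 h1 h2
    exact continuousAt_branchMap _ h0 h1.continuousAt h2.continuousAt)
  rw [hA] at key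
  specialize key (tendsto_branchDeriv _ hr (hg.tendsto_fderiv_add hr hb hz)
    (hg.tendsto_fderiv_sub hr hr0 hb hz) (hg.tendsto_fderiv_add_sub hr hr0 hb hz))
    (hg.tendsto_branchMap hF hz₀F hcrit)
  obtain ⟨ζ, s₀, ρ, hs₀, hρ, hcont, hlim, hzero, huniq⟩ := key
  refine ⟨ζ, s₀, ρ, hs₀, hρ, hcont, hlim,
    fun s hs => (branchMap_eq_zero_iff hF hs.1.ne' _ _).1 (hzero s hs),
    fun s hs ξ hξ h1 h2 => huniq s hs ξ hξ ((branchMap_eq_zero_iff hF hs.1.ne' _ _).2 ⟨h1, h2⟩)⟩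

end Branch

end

/-! ### Compactness: asymptotics of arbitrary small orbits -/

section

variable {E : Type*} [NormedAddCommGroup E] [InnerProductSpace ℝ E] {g : E → E} {w : E}
  {J : GradientJet E} {ι : Type*} {h a : ι → E} {μ : ι → ℝ}

/-- Adding the equations cancels `± μ a`, so by the parallelogram law `H h` is bounded by a multiple
of `‖h‖² + ‖a‖²`. Invertibility of `H` and smallness of `h` absorb the `‖h‖²` term. -/
theorem HasJet.isBigO_center {l : Filter ι} (hg : HasJet g w J) (hh : Tendsto h l (𝓝 0))
    (ha : Tendsto a l (𝓝 0)) (hp : ∀ᶠ i in l, g (w + (h i + a i)) = μ i • a i)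
    (hm : ∀ᶠ i in l, g (w + (h i - a i)) = -(μ i • a i)) :
    ∃ C, ∀ᶠ i in l, ‖h i‖ ≤ C * ‖a i‖ ^ 2 := by
  have hT := taylor_two (hg.contDiffAt.of_le (by norm_num : (2 : WithTop ℕ∞) ≤ 3))
  simp only [hg.map_eq_zero, hg.fderiv_eq, hg.fderiv_fderiv_eq, sub_zero,
    ContinuousLinearEquiv.coe_coe] at hT
  have hTT : (fun k : E => (1 / 2 : ℝ) • J.T k k) =O[𝓝 0] fun k => ‖k‖ ^ 2 := by
    refine IsBigO.of_bound (‖(1 / 2 : ℝ)‖ * ‖J.T‖) (Eventually.of_forall fun k => ?_)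
    rw [norm_smul, Real.norm_of_nonneg (by positivity : 0 ≤ ‖k‖ ^ 2), mul_assoc]
    have := J.T.le_opNorm₂ k k
    gcongr
    linarith [this]
  obtain ⟨C, hC, hb⟩ := (hT.isBigO.add hTT).exists_pos
  rw [IsBigOWith] at hb
  have hplus : Tendsto (fun i => h i + a i) l (𝓝 0) := by simpa using hh.add ha
  have hminus : Tendsto (fun i => h i - a i) l (𝓝 0) := by simpa using hh.sub ha
  set N : ℝ := ‖(J.H.symm : E →L[ℝ] E)‖ with hN
  have hN0 : 0 ≤ N := norm_nonneg _
  -- This gives `C N ‖h‖ ≤ 1/4`, enough for the absorption; the `+ 1` makes the denominator positive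
  -- even if `N = 0`.
  have hsmall : ∀ᶠ i in l, ‖h i‖ < 1 / (4 * (C * N + 1)) := by
    have := hh.norm
    rw [norm_zero] at this
    exact this.eventually (gt_mem_nhds (by positivity))
  refine ⟨4 * C * N, ?_⟩
  filter_upwards [hp, hm, hplus.eventually hb, hminus.eventually hb, hsmall] with i h1 h2 h3 h4 h5
  simp only [sub_add_cancel, norm_pow, norm_norm] at h3 h4
  rw [h1] at h3
  rw [h2] at h4
  have e1 : ‖(2 : ℝ) • J.H (h i)‖ ≤ C * ‖h i + a i‖ ^ 2 + C * ‖h i - a i‖ ^ 2 := by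
    have : (2 : ℝ) • J.H (h i) = -((μ i • a i - J.H (h i + a i)) +
        (-(μ i • a i) - J.H (h i - a i))) := by
      rw [map_add, map_sub]; module
    rw [this, norm_neg]
    exact (norm_add_le _ _).trans (add_le_add h3 h4)
  have e2 : ‖h i + a i‖ ^ 2 + ‖h i - a i‖ ^ 2 = 2 * (‖h i‖ ^ 2 + ‖a i‖ ^ 2) := by
    have := parallelogram_law_with_norm ℝ (h i) (a i)
    simpa only [pow_two] using this
  rw [← mul_add, e2, norm_smul, Real.norm_of_nonneg (by norm_num : (0 : ℝ) ≤ 2)] at e1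
  have e3 : ‖h i‖ ≤ N * ‖J.H (h i)‖ := by
    simpa using (J.H.symm : E →L[ℝ] E).le_opNorm (J.H (h i))
  have e4 : ‖h i‖ ≤ N * (C * (‖h i‖ ^ 2 + ‖a i‖ ^ 2)) :=
    e3.trans (mul_le_mul_of_nonneg_left (by linarith) hN0)
  have e5 : C * N * ‖h i‖ ≤ 1 / 4 := by
    rw [lt_div_iff₀ (by positivity)] at h5
    nlinarith [norm_nonneg (h i)]
  have e6 : C * N * ‖h i‖ * ‖h i‖ ≤ 1 / 4 * ‖h i‖ := by gcongr
  have e7 : 0 ≤ C * N * ‖a i‖ ^ 2 := by positivity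
  nlinarith

/-- Along an ultrafilter of shrinking period-two orbits, the direction converges to a critical
direction, and the rescaled center and eigenvalue shift converge to the predicted values. -/
theorem HasJet.exists_tendsto_direction [FiniteDimensional ℝ E] {F : Submodule ℝ E} {μc : ℝ}
    {U : Ultrafilter ι} (hg : HasJet g w J) (hF : ∀ e, e ∈ F ↔ J.H e = μc • e)
    (hh : Tendsto h U (𝓝 0)) (ha : Tendsto a U (𝓝 0)) (ha0 : ∀ᶠ i in (U : Filter ι), a i ≠ 0)
    (hμ : Tendsto μ U (𝓝 μc)) (hp : ∀ᶠ i in (U : Filter ι), g (w + (h i + a i)) = μ i • a i)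
    (hm : ∀ᶠ i in (U : Filter ι), g (w + (h i - a i)) = -(μ i • a i)) :
    ∃ ν : E, ν ∈ F ∧ ‖ν‖ = 1 ∧ Tendsto (fun i => ‖a i‖⁻¹ • a i) U (𝓝 ν) ∧
      Tendsto (fun i => (‖a i‖ ^ 2)⁻¹ • h i) U (𝓝 (J.center ν)) ∧
      Tendsto (fun i => (μ i - μc) / ‖a i‖ ^ 2) U (𝓝 (J.quart ν)) ∧
      ∀ e ∈ F, inner ℝ (J.cubic ν) e = J.quart ν * inner ℝ ν e := by
  have := FiniteDimensional.proper ℝ E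
  obtain ⟨C, hC⟩ := hg.isBigO_center hh ha hp hm
  set r : ι → ℝ := fun i => ‖a i‖ with hr
  set z : ι → E := fun i => (r i)⁻¹ • a i with hz
  set b : ι → E := fun i => (r i ^ 2)⁻¹ • h i with hb
  have hrpos : ∀ᶠ i in (U : Filter ι), 0 < r i := ha0.mono fun i hi => norm_pos_iff.2 hi
  have hr0 : ∀ᶠ i in (U : Filter ι), r i ≠ 0 := hrpos.mono fun i hi => hi.ne'
  have hrlim : Tendsto r U (𝓝 0) := by simpa using ha.norm
  -- An ultrafilter converges in any compact set it contains, so no subsequences are needed: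
  -- directions live in the unit sphere, and rescaled midpoints in the ball of radius `C` from
  -- `isBigO_center`.
  obtain ⟨ν, hν, hνlim⟩ := (isCompact_sphere (0 : E) 1).ultrafilter_le_nhds (U.map z) (by
    rw [Ultrafilter.coe_map, le_principal_iff, mem_map]
    filter_upwards [hrpos] with i hi
    have : ‖a i‖ ≠ 0 := hi.ne'
    simp [hz, hr, norm_smul, this])
  obtain ⟨b₀, -, hblim⟩ := (isCompact_closedBall (0 : E) C).ultrafilter_le_nhds (U.map b) (by
    rw [Ultrafilter.coe_map, le_principal_iff, mem_map]
    filter_upwards [hrpos, hC] with i hi hCi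
    have h2 : 0 < r i ^ 2 := by positivity
    rw [Set.mem_preimage, mem_closedBall_zero_iff, hb, norm_smul, norm_inv,
      Real.norm_of_nonneg h2.le, inv_mul_le_iff₀ h2, mul_comm]
    exact hCi)
  have hνlim : Tendsto z U (𝓝 ν) := hνlim
  have hblim : Tendsto b U (𝓝 b₀) := hblim
  have hν1 : ‖ν‖ = 1 := by simpa using hν
  have hplus : ∀ᶠ i in (U : Filter ι), h i + a i = r i • (r i • b i + z i) := by
    filter_upwards [hr0] with i hi
    simp only [hb, hz]
    match_scalars <;> field_simp
  have hminus : ∀ᶠ i in (U : Filter ι), h i - a i = r i • (r i • b i - z i) := by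
    filter_upwards [hr0] with i hi
    simp only [hb, hz]
    match_scalars <;> field_simp
  have haz : ∀ᶠ i in (U : Filter ι), a i = r i • z i := by
    filter_upwards [hr0] with i hi
    simp only [hz]
    match_scalars; field_simp
  have heven := hg.tendsto_evenPart hrlim hr0 hblim hνlim
  have hodd := hg.tendsto_oddPart hrlim hr0 hblim hνlim
  have hb₀ : b₀ = J.center ν := by
    have h0 : Tendsto (fun i => evenPart g w (r i) (b i) (z i)) U (𝓝 0) := by
      refine tendsto_const_nhds.congr' ?_
      filter_upwards [hp, hm, hplus, hminus] with i h1 h2 h3 h4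
      rw [evenPart, ← h3, ← h4, h1, h2]
      simp
    have h1 := tendsto_nhds_unique heven h0
    have h2 := J.H_center ν
    exact J.H.injective (add_right_cancel (h1.trans h2.symm))
  rw [hb₀] at hodd hblim
  have hbal : ∀ᶠ i in (U : Filter ι), J.H (z i) - μ i • z i +
      r i ^ 2 • oddPart g J.H w (r i) (b i) (z i) = 0 := by
    filter_upwards [hp, hm, hplus, hminus, haz, hr0] with i h1 h2 h3 h4 h5 h6
    rw [oddPart, ← h3, ← h4, h1, h2, ContinuousLinearEquiv.coe_coe]
    have h7 : μ i • a i = μ i • r i • z i := congrArg (μ i • ·) h5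
    rw [h7]
    match_scalars <;> field_simp <;> ring
  have hνF : ν ∈ F := by
    rw [hF, ← sub_eq_zero]
    have h1 := (((J.H.continuous.tendsto ν).comp hνlim).sub (hμ.smul hνlim)).add
      ((hrlim.pow 2).smul hodd)
    have h2 := tendsto_nhds_unique h1 (tendsto_const_nhds.congr' (hbal.mono fun i hi => hi.symm))
    simpa using h2
  -- Pairing with `e ∈ F` turns `H z` into `μc z`, so division by `r²` leaves only the rescaled
  -- eigenvalue shift.
  have hproj : ∀ e ∈ F, ∀ᶠ i in (U : Filter ι), (μ i - μc) / r i ^ 2 * inner ℝ (z i) e =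
      inner ℝ (oddPart g J.H w (r i) (b i) (z i)) e := by
    intro e he
    filter_upwards [hbal, hr0] with i h1 h2
    have h3 := congrArg (fun x : E => (inner ℝ x e : ℝ)) h1
    simp only [inner_add_left, inner_sub_left, inner_smul_left, J.inner_H, (hF e).1 he,
      inner_smul_right, inner_zero_left, conj_trivial] at h3
    field_simp
    linarith
  -- Take `e = ν` in `hproj`: since `⟨z, ν⟩ → 1`, one may divide and read off the limit of the
  -- shift.
  have hmlim : Tendsto (fun i => (μ i - μc) / r i ^ 2) U (𝓝 (J.quart ν)) := by
    have h1 : Tendsto (fun i => inner ℝ (z i) ν) U (𝓝 (1 : ℝ)) := by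
      have := hνlim.inner (𝕜 := ℝ) (tendsto_const_nhds (x := ν))
      rwa [real_inner_self_eq_norm_sq, hν1, one_pow] at this
    have h2 := (hodd.inner (𝕜 := ℝ) (tendsto_const_nhds (x := ν))).div h1 one_ne_zero
    rw [div_one] at h2
    refine h2.congr' ?_
    filter_upwards [hproj ν hνF, h1.eventually_ne one_ne_zero] with i h3 h4
    rw [Pi.div_apply, ← h3, mul_div_cancel_right₀ _ h4]
  refine ⟨ν, hνF, hν1, hνlim, hblim, hmlim, fun e he => ?_⟩
  exact tendsto_nhds_unique (hodd.inner (𝕜 := ℝ) tendsto_const_nhds)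
    ((hmlim.mul (hνlim.inner (𝕜 := ℝ) tendsto_const_nhds)).congr' (hproj e he))

end

/-! ### Translation to period-two orbits; tangency; one-dimensional critical space -/

section

variable {E : Type*} [NormedAddCommGroup E] [InnerProductSpace ℝ E]

theorem direction_swap (x y : E) : direction y x = -direction x y := by
  rw [direction, direction, norm_sub_rev, ← smul_neg, neg_sub]

theorem direction_eq (x y : E) :
    direction x y = ‖(1 / 2 : ℝ) • (y - x)‖⁻¹ • (1 / 2 : ℝ) • (y - x) := by
  rw [direction, norm_smul, smul_smul]
  congr 1
  norm_num
  ring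

/-- The tangent space of the sphere is zero, so both conditions are vacuous for any `f`. -/
theorem isSphereNondegenerate_of_finrank_eq_one {f : E → ℝ} {F : Submodule ℝ E}
    (hF : Module.finrank ℝ F = 1) {u : E} (hu : u ∈ F) (hu1 : ‖u‖ = 1) :
    IsSphereNondegenerate f F u := by
  have hu0 : u ≠ 0 := by rintro rfl; simp at hu1
  have hzero : ∀ v : sphereTangent F u, v = 0 := by
    intro v
    obtain ⟨c, hc⟩ := (finrank_eq_one_iff_of_nonzero' (⟨u, hu⟩ : F) (by simpa using hu0)).1 hF
      ⟨v, v.2.1⟩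
    have hc : c • u = v := congrArg Subtype.val hc
    have h := Submodule.mem_orthogonal_singleton_iff_inner_right.1 v.2.2
    rw [← hc, inner_smul_right, real_inner_self_eq_norm_sq, hu1] at h
    have hc0 : c = 0 := by simpa using h
    exact Subtype.ext (by rw [← hc, hc0, zero_smul]; rfl)
  refine ⟨⟨hu, hu1, ?_⟩, fun v _ => hzero v⟩
  ext v
  rw [hzero v, map_zero, map_zero]

variable [CompleteSpace E] {L : E → ℝ} {w : E} {η ηc : ℝ}

theorem isPeriodTwoOrbit_add_sub_iff (hη : η ≠ 0) (h a : E) :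
    IsPeriodTwoOrbit L η (w + (h - a)) (w + (h + a)) ↔ a ≠ 0 ∧
      gradient L (w + (h + a)) = (2 / η) • a ∧ gradient L (w + (h - a)) = -((2 / η) • a) := by
  have hne : w + (h - a) ≠ w + (h + a) ↔ a ≠ 0 := by
    rw [not_iff_not, add_right_inj, ← sub_eq_zero]
    have : h - a - (h + a) = (-2 : ℝ) • a := by module
    rw [this, smul_eq_zero_iff_right (by norm_num)]
  have h1 : w + (h - a) = w + (h + a) - η • gradient L (w + (h + a)) ↔
      gradient L (w + (h + a)) = (2 / η) • a := by
    generalize gradient L (w + (h + a)) = p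
    have : w + (h - a) - (w + (h + a) - η • p) = η • (p - (2 / η) • a) := by
      match_scalars <;> field_simp <;> norm_num
    rw [← sub_eq_zero, this, smul_eq_zero_iff_right hη, sub_eq_zero]
  have h2 : w + (h + a) = w + (h - a) - η • gradient L (w + (h - a)) ↔
      gradient L (w + (h - a)) = -((2 / η) • a) := by
    generalize gradient L (w + (h - a)) = p
    have : w + (h + a) - (w + (h - a) - η • p) = η • (p - (-((2 / η) • a))) := by
      match_scalars <;> field_simp <;> norm_num
    rw [← sub_eq_zero, this, smul_eq_zero_iff_right hη, sub_eq_zero]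
  rw [← hne, ← h1, ← h2]
  exact ⟨fun h => ⟨h.1, h.3, h.2⟩, fun h => ⟨h.1, h.2.2, h.2.1⟩⟩

theorem IsPeriodTwoOrbit.symm {x y : E} (h : IsPeriodTwoOrbit L η x y) :
    IsPeriodTwoOrbit L η y x := ⟨h.ne.symm, h.step_right, h.step_left⟩

theorem mem_critSpace_iff (hL : ContDiffAt ℝ 4 L w) (hinv : (hess L w).IsInvertible) (e : E) :
    e ∈ critSpace L w ηc ↔ (gradientJet hL hinv).H e = (2 / ηc) • e := by
  have h : hess L w e = (gradientJet hL hinv).H e :=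
    (DFunLike.congr_fun (gradientJet_H hL hinv) e).symm
  rw [critSpace, LinearMap.mem_ker, ContinuousLinearMap.coe_coe, sub_apply, h, smul_apply,
    ContinuousLinearMap.id_apply, sub_eq_zero]

variable [FiniteDimensional ℝ E]

theorem exists_tendsto_direction_of_orbit (hL : ContDiffAt ℝ 4 L w) (hcrit : gradient L w = 0)
    (hinv : (hess L w).IsInvertible) (hηc : 0 < ηc) {U : Ultrafilter (ℝ × E × E)}
    (hU : (U : Filter (ℝ × E × E)) ≤ 𝓝 (ηc, w, w))
    (horb : ∀ᶠ p in (U : Filter (ℝ × E × E)), IsPeriodTwoOrbit L p.1 p.2.1 p.2.2) :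
    ∃ ν : E, IsSphereCritical (quartic L w) (critSpace L w ηc) ν ∧
      Tendsto (fun p : ℝ × E × E => direction p.2.1 p.2.2) U (𝓝 ν) ∧
      Tendsto (fun p : ℝ × E × E => (‖(1 / 2 : ℝ) • (p.2.2 - p.2.1)‖ ^ 2)⁻¹ •
        ((1 / 2 : ℝ) • (p.2.1 + p.2.2) - w)) U (𝓝 ((gradientJet hL hinv).center ν)) ∧
      Tendsto (fun p : ℝ × E × E => (2 / p.1 - 2 / ηc) / ‖(1 / 2 : ℝ) • (p.2.2 - p.2.1)‖ ^ 2) U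
        (𝓝 (quartic L w ν)) := by
  have hid : Tendsto (fun p : ℝ × E × E => p) U (𝓝 (ηc, w, w)) := hU
  have hη : Tendsto (fun p : ℝ × E × E => p.1) U (𝓝 ηc) := (continuous_fst.tendsto _).comp hid
  have hη0 : ∀ᶠ p : ℝ × E × E in U, p.1 ≠ 0 := hη.eventually_ne hηc.ne'
  have hh : Tendsto (fun p : ℝ × E × E => (1 / 2 : ℝ) • (p.2.1 + p.2.2) - w) U (𝓝 0) := by
    have hc : Continuous fun p : ℝ × E × E => (1 / 2 : ℝ) • (p.2.1 + p.2.2) - w := by fun_prop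
    have := (hc.tendsto (ηc, w, w)).comp hid
    have h0 : (1 / 2 : ℝ) • (w + w) - w = 0 := by module
    rwa [h0] at this
  have ha : Tendsto (fun p : ℝ × E × E => (1 / 2 : ℝ) • (p.2.2 - p.2.1)) U (𝓝 0) := by
    have hc : Continuous fun p : ℝ × E × E => (1 / 2 : ℝ) • (p.2.2 - p.2.1) := by fun_prop
    have := (hc.tendsto (ηc, w, w)).comp hid
    rwa [sub_self, smul_zero] at this
  have hev : ∀ᶠ p : ℝ × E × E in U, (1 / 2 : ℝ) • (p.2.2 - p.2.1) ≠ 0 ∧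
      gradient L (w + ((1 / 2 : ℝ) • (p.2.1 + p.2.2) - w + (1 / 2 : ℝ) • (p.2.2 - p.2.1))) =
        (2 / p.1) • (1 / 2 : ℝ) • (p.2.2 - p.2.1) ∧
      gradient L (w + ((1 / 2 : ℝ) • (p.2.1 + p.2.2) - w - (1 / 2 : ℝ) • (p.2.2 - p.2.1))) =
        -((2 / p.1) • (1 / 2 : ℝ) • (p.2.2 - p.2.1)) := by
    filter_upwards [horb, hη0] with p hp h0
    refine (isPeriodTwoOrbit_add_sub_iff (L := L) (w := w) h0
      ((1 / 2 : ℝ) • (p.2.1 + p.2.2) - w) ((1 / 2 : ℝ) • (p.2.2 - p.2.1))).1 ?_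
    convert hp using 1 <;> module
  obtain ⟨ν, hνF, hν1, h1, h2, h3, h4⟩ :=
    (hasJet_gradientJet hL hcrit hinv).exists_tendsto_direction
    (mem_critSpace_iff (ηc := ηc) hL hinv) hh ha (hev.mono fun _ h => h.1)
    (tendsto_const_nhds.div hη hηc.ne') (hev.mono fun _ h => h.2.1) (hev.mono fun _ h => h.2.2)
  rw [quartic_eq_quart hL hinv]
  refine ⟨ν, (GradientJet.isSphereCritical_quart_iff hνF hν1).2 h4, ?_, h2, h3⟩
  simpa only [direction_eq] using h1

theorem exists_critical_near_direction (hL : ContDiffAt ℝ 4 L w) (hcrit : gradient L w = 0)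
    (hinv : (hess L w).IsInvertible) (hηc : 0 < ηc) {ε : ℝ} (hε : 0 < ε) :
    ∃ δ > 0, ∀ (η : ℝ) (x y : E), |η - ηc| < δ → IsPeriodTwoOrbit L η x y → ‖x - w‖ < δ →
      ‖y - w‖ < δ → ∃ v : E, IsSphereCritical (quartic L w) (critSpace L w ηc) v ∧
        ‖direction x y - v‖ < ε := by
  have hev : ∀ᶠ p : ℝ × E × E in 𝓝 (ηc, w, w) ⊓ 𝓟 {p | IsPeriodTwoOrbit L p.1 p.2.1 p.2.2},
      ∃ v : E, IsSphereCritical (quartic L w) (critSpace L w ηc) v ∧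
        ‖direction p.2.1 p.2.2 - v‖ < ε := by
    refine mem_iff_ultrafilter.2 fun U hU => ?_
    obtain ⟨ν, hν, h1, -, -⟩ := exists_tendsto_direction_of_orbit hL hcrit hinv hηc
      (hU.trans inf_le_left) (le_principal_iff.1 (hU.trans inf_le_right))
    filter_upwards [h1.eventually (Metric.ball_mem_nhds ν hε)] with p hp
    exact ⟨ν, hν, by simpa [dist_eq_norm] using hp⟩
  rw [eventually_inf_principal] at hev
  obtain ⟨δ, hδ, hb⟩ := Metric.eventually_nhds_iff.1 hev
  refine ⟨δ, hδ, fun η x y hη horb hx hy => hb (y := (η, x, y)) ?_ horb⟩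
  simp [dist_eq_norm, hη, hx, hy]

end

/-! ### The branch parametrised by the step size -/

section

/-- The blow-up parameter `√|2/η - 2/η_c|`. -/
def edgeScale (ηc η : ℝ) : ℝ := √|2 / η - 2 / ηc|

section Scale

variable {ηc η q : ℝ}

theorem edgeScale_sq : edgeScale ηc η ^ 2 = |2 / η - 2 / ηc| := Real.sq_sqrt (abs_nonneg _)

theorem edgeScale_pos (h : η ∈ branchSide ηc q) : 0 < edgeScale ηc η :=
  Real.sqrt_pos.2 (abs_pos.2 fun h0 => by simpa [h0] using h.2)

theorem continuousAt_edgeScale (h : η ≠ 0) : ContinuousAt (edgeScale ηc) η := by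
  unfold edgeScale
  fun_prop (disch := assumption)

/-- On this side `2/η - 2/η_c` has the sign of `q`. It puts the step size in the form `2/η = 2/η_c +
σ s²` with `σ = q/|q|`, as required by `HasJet.exists_branch`. -/
theorem sub_eq_of_mem_branchSide (h : η ∈ branchSide ηc q) :
    2 / η - 2 / ηc = q / |q| * edgeScale ηc η ^ 2 := by
  have hm := h.2
  rw [edgeScale_sq]
  rcases lt_trichotomy q 0 with hq | hq | hq
  · have : 2 / η - 2 / ηc < 0 := by nlinarith
    rw [abs_of_neg hq, abs_of_neg this, div_neg, div_self hq.ne]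
    ring
  · simp [hq] at hm
  · have : 0 < 2 / η - 2 / ηc := by nlinarith
    rw [abs_of_pos hq, abs_of_pos this, div_self hq.ne', one_mul]

theorem tendsto_edgeScale (hηc : 0 < ηc) :
    Tendsto (edgeScale ηc) (𝓝[branchSide ηc q] ηc) (𝓝[>] 0) := by
  refine tendsto_nhdsWithin_iff.2 ⟨?_, eventually_mem_nhdsWithin.mono fun η h => edgeScale_pos h⟩
  have := (continuousAt_edgeScale (ηc := ηc) hηc.ne').tendsto
  simp only [edgeScale, sub_self, abs_zero, Real.sqrt_zero] at this
  exact this.mono_left nhdsWithin_le_nhds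

theorem edgeScale_isBigO (hηc : 0 < ηc) :
    edgeScale ηc =O[𝓝 ηc] fun η => √|η - ηc| := by
  refine IsBigO.of_bound (2 / ηc) ?_
  -- For `η > η_c/2` the factor `2/(η η_c)` is at most `(2/η_c)²`.
  filter_upwards [lt_mem_nhds (half_lt_self hηc)] with η hη
  have hη0 : 0 < η := by linarith
  rw [Real.norm_of_nonneg (Real.sqrt_nonneg _), edgeScale, Real.norm_of_nonneg (Real.sqrt_nonneg _)]
  have h2 : (0 : ℝ) ≤ 2 / ηc := by positivity
  refine (Real.sqrt_le_sqrt (?_ : _ ≤ (2 / ηc) ^ 2 * |η - ηc|)).trans_eq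
    (by rw [Real.sqrt_mul (sq_nonneg _), Real.sqrt_sq h2])
  have h3 : 2 / η - 2 / ηc = -(2 / (η * ηc)) * (η - ηc) := by field_simp; ring
  rw [h3, abs_mul, abs_neg, abs_of_pos (by positivity)]
  gcongr
  rw [div_pow, div_le_div_iff₀ (by positivity) (by positivity)]
  nlinarith [mul_pos hηc hηc, mul_pos hη0 hηc]

end Scale

variable {E : Type*} [NormedAddCommGroup E] [InnerProductSpace ℝ E] [CompleteSpace E]
  [FiniteDimensional ℝ E] {L : E → ℝ} {w u : E} {ηc : ℝ}

/-- Small period-two orbits with direction near `u`, where the quartic does not vanish, lie on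
the side `branchSide` and, in blown-up coordinates, near the predicted point. -/
theorem eventually_blowup_mem_closedBall (hL : ContDiffAt ℝ 4 L w) (hcrit : gradient L w = 0)
    (hinv : (hess L w).IsInvertible) (hηc : 0 < ηc) (hq : quartic L w u ≠ 0) {s₀ ρ : ℝ}
    (hs₀ : 0 < s₀) (hρ : 0 < ρ) :
    ∀ᶠ p : ℝ × E × E in 𝓝 (ηc, w, w) ⊓ comap (fun p => direction p.2.1 p.2.2) (𝓝 u),
      IsPeriodTwoOrbit L p.1 p.2.1 p.2.2 → p.1 ∈ branchSide ηc (quartic L w u) ∧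
        edgeScale ηc p.1 < s₀ ∧
        ((edgeScale ηc p.1 ^ 2)⁻¹ • ((1 / 2 : ℝ) • (p.2.1 + p.2.2) - w),
          (edgeScale ηc p.1)⁻¹ • (1 / 2 : ℝ) • (p.2.2 - p.2.1)) ∈ Metric.closedBall
          ((gradientJet hL hinv).center ((√|quartic L w u|)⁻¹ • u), (√|quartic L w u|)⁻¹ • u) ρ := by
  refine (eventually_inf_principal
    (s := {p : ℝ × E × E | IsPeriodTwoOrbit L p.1 p.2.1 p.2.2})).1 ?_
  refine mem_iff_ultrafilter.2 fun U hU => ?_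
  have hU1 : (U : Filter (ℝ × E × E)) ≤ 𝓝 (ηc, w, w) := hU.trans (inf_le_left.trans inf_le_left)
  have horb := le_principal_iff.1 (hU.trans inf_le_right)
  have hdir : Tendsto (fun p : ℝ × E × E => direction p.2.1 p.2.2) U (𝓝 u) :=
    tendsto_iff_comap.2 (hU.trans (inf_le_left.trans inf_le_right))
  obtain ⟨ν, -, h1, h2, h3⟩ := exists_tendsto_direction_of_orbit hL hcrit hinv hηc hU1 horb
  obtain rfl : ν = u := tendsto_nhds_unique h1 hdir
  set q := quartic L w ν with hqdef
  set r : ℝ × E × E → ℝ := fun p => ‖(1 / 2 : ℝ) • (p.2.2 - p.2.1)‖ with hr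
  set s : ℝ × E × E → ℝ := fun p => edgeScale ηc p.1 with hs
  have hη : Tendsto (fun p : ℝ × E × E => p.1) U (𝓝 ηc) :=
    (continuous_fst.tendsto (ηc, w, w)).comp hU1
  have hrpos : ∀ᶠ p in (U : Filter (ℝ × E × E)), 0 < r p := by
    filter_upwards [horb] with p hp
    exact norm_pos_iff.2 (smul_ne_zero (by norm_num) (sub_ne_zero.2 hp.ne.symm))
  have hside : ∀ᶠ p in (U : Filter (ℝ × E × E)), p.1 ∈ branchSide ηc q := by
    have h4 := h3.mul_const q
    filter_upwards [h4.eventually (lt_mem_nhds (mul_self_pos.2 hq)), hrpos,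
      hη.eventually (lt_mem_nhds hηc)] with p hp hrp hηp
    refine ⟨hηp, ?_⟩
    have h5 : (2 / p.1 - 2 / ηc) * q = (2 / p.1 - 2 / ηc) / r p ^ 2 * q * r p ^ 2 := by
      field_simp
    rw [h5]
    positivity
  have hs0 : Tendsto s U (𝓝 0) := by
    have := (continuousAt_edgeScale (ηc := ηc) hηc.ne').tendsto
    simp only [edgeScale, sub_self, abs_zero, Real.sqrt_zero] at this
    exact this.comp hη
  -- The shift divided by `r²` tends to `q`; its absolute value is `(s/r)²`, whence `r/s → 1/√|q|`.
  have hratio : Tendsto (fun p => r p / s p) U (𝓝 (√|q|)⁻¹) := by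
    have h4 := (h3.abs.sqrt).inv₀ (Real.sqrt_ne_zero'.2 (abs_pos.2 hq))
    refine h4.congr' ?_
    filter_upwards [hrpos] with p hp
    rw [abs_div, abs_of_pos (pow_pos hp 2), Real.sqrt_div (abs_nonneg _), Real.sqrt_sq hp.le,
      inv_div]
    rfl
  have hb := (hratio.pow 2).smul h2
  have hz := hratio.smul h1
  rw [← GradientJet.center_smul] at hb
  have hball := (hb.prodMk_nhds hz).eventually (Metric.closedBall_mem_nhds _ hρ)
  filter_upwards [hside, hs0.eventually (gt_mem_nhds hs₀), hball, hrpos] with p hp1 hp2 hp3 hp4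
  refine ⟨hp1, hp2, ?_⟩
  have hs1 : 0 < s p := edgeScale_pos hp1
  rw [smul_smul, direction_eq, smul_smul] at hp3
  have e1 : (r p / s p) ^ 2 * (‖(1 / 2 : ℝ) • (p.2.2 - p.2.1)‖ ^ 2)⁻¹ =
      (edgeScale ηc p.1 ^ 2)⁻¹ := by
    change (r p / s p) ^ 2 * (r p ^ 2)⁻¹ = (s p ^ 2)⁻¹
    field_simp
  have e2 : r p / s p * ‖(1 / 2 : ℝ) • (p.2.2 - p.2.1)‖⁻¹ = (edgeScale ηc p.1)⁻¹ := by
    change r p / s p * (r p)⁻¹ = (s p)⁻¹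
    field_simp
  rw [e1, e2] at hp3
  exact hp3

theorem exists_branch_of_isSphereNondegenerate (hL : ContDiffAt ℝ 4 L w)
    (hcrit : gradient L w = 0) (hinv : (hess L w).IsInvertible) (hηc : 0 < ηc)
    (hu : IsSphereNondegenerate (quartic L w) (critSpace L w ηc) u) (hq : quartic L w u ≠ 0) :
    ∃ (δ : ℝ) (c a : ℝ → E) (α : ℝ → ℝ), 0 < δ ∧ δ < ηc ∧
      (∀ η ∈ branchSide ηc (quartic L w u), |η - ηc| < δ →
        IsPeriodTwoOrbit L η (c η - a η) (c η + a η) ∧ 0 < α η) ∧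
      ContinuousOn c (branchSide ηc (quartic L w u) ∩ Metric.ball ηc δ) ∧
      ContinuousOn a (branchSide ηc (quartic L w u) ∩ Metric.ball ηc δ) ∧
      Tendsto c (𝓝[branchSide ηc (quartic L w u)] ηc) (𝓝 w) ∧
      (fun η => a η - α η • u) =o[𝓝[branchSide ηc (quartic L w u)] ηc] (fun η => √|η - ηc|) ∧
      (fun η => α η ^ 2 - (2 / η - 2 / ηc) / quartic L w u)
        =o[𝓝[branchSide ηc (quartic L w u)] ηc] (fun η => |η - ηc|) ∧
      ∀ (η : ℝ) (x y : E), |η - ηc| < δ → IsPeriodTwoOrbit L η x y → ‖x - w‖ < δ → ‖y - w‖ < δ →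
        (‖direction x y - u‖ < δ ∨ ‖direction x y + u‖ < δ) →
        η ∈ branchSide ηc (quartic L w u) ∧
        ((x = c η - a η ∧ y = c η + a η) ∨ (x = c η + a η ∧ y = c η - a η)) := by
  set q := quartic L w u with hqdef
  set J := gradientJet hL hinv with hJ
  have hquart : quartic L w = J.quart := quartic_eq_quart hL hinv
  rw [hquart] at hu
  have hqJ : J.quart u = q := by rw [hqdef, hquart]
  -- The blown-up limit is `z₀ = t u`. Cubic homogeneity turns the multiplier `q` at `u` into `t² q`
  -- at `t u`, and this `t` makes it equal to `σ = q/|q|`.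
  set t : ℝ := (√|q|)⁻¹ with ht
  have htpos : 0 < t := inv_pos.2 (Real.sqrt_pos.2 (abs_pos.2 hq))
  have htq : t ^ 2 = |q|⁻¹ := by rw [ht, inv_pow, Real.sq_sqrt (abs_nonneg _)]
  have hσ : q / |q| = t ^ 2 * q := by rw [htq]; ring
  have hu0 : u ≠ 0 := fun h => by simpa [h] using hu.norm_eq
  have hucrit := (GradientJet.isSphereCritical_quart_iff hu.mem hu.norm_eq).1 hu.toIsSphereCritical
  obtain ⟨ζ, s₁, ρ, hs₁, hρ, hζc, hζlim, hζorb, hζuniq⟩ :=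
    (hasJet_gradientJet hL hcrit hinv).exists_branch (μc := 2 / ηc) (σ := q / |q|) (z₀ := t • u)
    (mem_critSpace_iff (ηc := ηc) hL hinv) (smul_ne_zero htpos.ne' hu0)
    ((critSpace L w ηc).smul_mem t hu.mem)
    (fun e he => by
      rw [GradientJet.cubic_smul, inner_smul_left, inner_smul_left, hucrit e he, hσ, hqJ]
      simp only [conj_trivial]; ring)
    (fun v hv hv' => by
      refine GradientJet.eq_zero_of_cubicDeriv_eq hu (by rwa [hqJ]) hv fun e he => ?_
      have h := hv' e he
      rw [GradientJet.cubicDeriv_smul, smul_apply, inner_smul_left, hσ, conj_trivial,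
        mul_assoc] at h
      rw [hqJ]
      exact mul_left_cancel₀ (pow_ne_zero 2 htpos.ne') h)
  have hζ2 : Tendsto (fun s => (ζ s).2) (𝓝[>] 0) (𝓝 (t • u)) :=
    (continuous_snd.tendsto _).comp hζlim
  have hζ1 : Tendsto (fun s => (ζ s).1) (𝓝[>] 0) (𝓝 (J.center (t • u))) :=
    (continuous_fst.tendsto _).comp hζlim
  -- Below `s₂` the half-difference is nonzero, so the orbit consists of two distinct points.
  obtain ⟨s₂, hs₂, hne⟩ := mem_nhdsGT_iff_exists_Ioo_subset.1
    (hζ2.eventually_ne (smul_ne_zero htpos.ne' hu0))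
  set s₀ := min s₁ s₂ with hs₀
  have hs₀pos : 0 < s₀ := lt_min hs₁ hs₂
  obtain ⟨δ₁, hδ₁, hsmall⟩ : ∃ δ₁ > 0, ∀ η, |η - ηc| < δ₁ → edgeScale ηc η < s₀ := by
    have h := (continuousAt_edgeScale (ηc := ηc) hηc.ne').tendsto
    simp only [edgeScale, sub_self, abs_zero, Real.sqrt_zero] at h
    obtain ⟨δ, hδ, h⟩ := Metric.eventually_nhds_iff.1 (h.eventually (gt_mem_nhds hs₀pos))
    exact ⟨δ, hδ, fun η hη => h hη⟩
  obtain ⟨⟨δ₂, δ₃⟩, ⟨hδ₂, hδ₃⟩, huniq⟩ := (Metric.nhds_basis_ball.inf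
    (Metric.nhds_basis_ball.comap _)).eventually_iff.1
    (eventually_blowup_mem_closedBall hL hcrit hinv hηc hq hs₀pos hρ)
  set c : ℝ → E := fun η => w + edgeScale ηc η ^ 2 • (ζ (edgeScale ηc η)).1 with hc
  set a : ℝ → E := fun η => edgeScale ηc η • (ζ (edgeScale ηc η)).2 with ha
  set δ := min (min δ₁ (ηc / 2)) (min δ₂ δ₃) with hδ
  have hδpos : 0 < δ := lt_min (lt_min hδ₁ (half_pos hηc)) (lt_min hδ₂ hδ₃)
  have hδ1 : δ ≤ δ₁ := (min_le_left _ _).trans (min_le_left _ _)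
  have hδ2 : δ ≤ δ₂ := (min_le_right _ _).trans (min_le_left _ _)
  have hδ3 : δ ≤ δ₃ := (min_le_right _ _).trans (min_le_right _ _)
  have hδηc : δ < ηc := ((min_le_left _ _).trans (min_le_right _ _)).trans_lt (half_lt_self hηc)
  have hmem : ∀ η ∈ branchSide ηc q, |η - ηc| < δ → edgeScale ηc η ∈ Set.Ioo 0 s₀ :=
    fun η hη h => ⟨edgeScale_pos hη, hsmall η (h.trans_le hδ1)⟩
  have hIoo : Set.Ioo 0 s₀ ⊆ Set.Ioo 0 s₁ := Set.Ioo_subset_Ioo_right (min_le_left _ _)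
  have hscont : ContinuousOn (edgeScale ηc) (branchSide ηc q ∩ Metric.ball ηc δ) :=
    fun η hη => (continuousAt_edgeScale hη.1.1.ne').continuousWithinAt
  have hζcont : ContinuousOn (fun η => ζ (edgeScale ηc η)) (branchSide ηc q ∩ Metric.ball ηc δ) :=
    hζc.comp hscont fun η hη => hIoo (hmem η hη.1 hη.2)
  have hslim := tendsto_edgeScale (q := q) hηc
  have hdirect : ∀ (η : ℝ) (x y : E), |η - ηc| < δ → IsPeriodTwoOrbit L η x y → ‖x - w‖ < δ →
      ‖y - w‖ < δ → ‖direction x y - u‖ < δ →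
      η ∈ branchSide ηc q ∧ x = c η - a η ∧ y = c η + a η := by
    intro η x y hη horb hx hy hd
    obtain ⟨hside, hlt, hball⟩ := huniq (x := (η, x, y)) (by
      refine ⟨?_, ?_⟩
      · simp [dist_eq_norm, hη.trans_le hδ2, hx.trans_le hδ2, hy.trans_le hδ2]
      · simpa [dist_eq_norm] using hd.trans_le hδ3) horb
    dsimp only at hside hlt hball
    set s := edgeScale ηc η with hs
    have hspos : 0 < s := edgeScale_pos hside
    have hμ : 2 / ηc + q / |q| * s ^ 2 = 2 / η := by
      rw [← sub_eq_of_mem_branchSide hside]; ring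
    have hη0 : η ≠ 0 := hside.1.ne'
    set h : E := (1 / 2 : ℝ) • (x + y) - w with hh
    set b : E := (1 / 2 : ℝ) • (y - x) with hb
    have hxe : x = w + (h - b) := by rw [hh, hb]; module
    have hye : y = w + (h + b) := by rw [hh, hb]; module
    have hiff := horb
    rw [hxe, hye, isPeriodTwoOrbit_add_sub_iff hη0] at hiff
    have hplus : s • (s • (s ^ 2)⁻¹ • h + s⁻¹ • b) = h + b := by
      match_scalars <;> field_simp
    have hminus : s • (s • (s ^ 2)⁻¹ • h - s⁻¹ • b) = h - b := by
      match_scalars <;> field_simp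
    have hsb : (s * (2 / ηc + q / |q| * s ^ 2)) • s⁻¹ • b = (2 / η) • b := by
      rw [hμ, smul_smul]; congr 1; field_simp
    have hζeq := hζuniq s (hIoo ⟨hspos, hlt⟩) _ hball
      (by rw [hplus, hsb]; exact hiff.2.1) (by rw [hminus, hsb]; exact hiff.2.2)
    have hceq : c η = w + h := by
      simp only [hc, ← hs, ← hζeq]
      rw [smul_inv_smul₀ (pow_ne_zero 2 hspos.ne')]
    have haeq : a η = b := by
      simp only [ha, ← hs, ← hζeq]
      rw [smul_inv_smul₀ hspos.ne']
    refine ⟨hside, ?_, ?_⟩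
    · rw [hceq, haeq, hxe]; abel
    · rw [hceq, haeq, hye]; abel
  -- Taking `α` to be exactly the leading term makes `α² = (2/η - 2/η_c)/q` hold without error; the
  -- whole error is carried by `a - α u`.
  refine ⟨δ, c, a, fun η => t * edgeScale ηc η, hδpos, hδηc, fun η hη hηδ => ⟨?_, ?_⟩, ?_, ?_, ?_,
    ?_, ?_, fun η x y hη horb hx hy hd => ?_⟩
  · set s := edgeScale ηc η with hs
    have hsm : s ∈ Set.Ioo 0 s₀ := hmem η hη hηδ
    have hμ : 2 / ηc + q / |q| * s ^ 2 = 2 / η := by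
      rw [← sub_eq_of_mem_branchSide hη]; ring
    have h := hζorb s (hIoo hsm)
    have e1 : c η - a η = w + (s ^ 2 • (ζ s).1 - s • (ζ s).2) := add_sub_assoc _ _ _
    have e2 : c η + a η = w + (s ^ 2 • (ζ s).1 + s • (ζ s).2) := add_assoc _ _ _
    rw [e1, e2, isPeriodTwoOrbit_add_sub_iff hη.1.ne']
    rw [hμ, mul_comm, mul_smul, smul_add, smul_sub, smul_smul, ← pow_two] at h
    exact ⟨smul_ne_zero hsm.1.ne' (hne ⟨hsm.1, hsm.2.trans_le (min_le_right _ _)⟩), h⟩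
  · exact mul_pos htpos (edgeScale_pos hη)
  · exact continuousOn_const.add ((hscont.pow 2).smul (continuous_fst.comp_continuousOn hζcont))
  · exact hscont.smul (continuous_snd.comp_continuousOn hζcont)
  · have h := (((hslim.mono_right nhdsWithin_le_nhds).pow 2).smul (hζ1.comp hslim)).const_add w
    simpa [hc] using h
  · have h1 : (fun η => (ζ (edgeScale ηc η)).2 - t • u) =o[𝓝[branchSide ηc q] ηc]
        fun _ => (1 : ℝ) := by
      rw [isLittleO_one_iff]
      simpa using (hζ2.comp hslim).sub_const (t • u)
    have h2 := ((edgeScale_isBigO hηc).mono nhdsWithin_le_nhds).smul_isLittleO h1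
    refine (h2.congr_left fun η => ?_).congr_right fun η => ?_
    · simp only [ha]; module
    · simp
  · refine (isLittleO_zero _ _).congr' ?_ EventuallyEq.rfl
    filter_upwards [eventually_mem_nhdsWithin] with η hη
    rw [sub_eq_of_mem_branchSide hη, mul_pow, htq]
    have : |q| ≠ 0 := abs_ne_zero.2 hq
    field_simp
    ring
  · rcases hd with hd | hd
    · obtain ⟨h1, h2⟩ := hdirect η x y hη horb hx hy hd
      exact ⟨h1, Or.inl h2⟩
    -- Swapping the two points reverses the direction, reducing to the case near `u`.
    · have hd' : ‖direction y x - u‖ < δ := by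
        rw [direction_swap, ← norm_neg]
        simpa [add_comm] using hd
      obtain ⟨h1, h2, h3⟩ := hdirect η y x hη horb.symm hy hx hd'
      exact ⟨h1, Or.inr ⟨h3, h2⟩⟩

end

end EdgeBranching

end

theorem mainTheorem6 (d : ℕ) (L : EuclideanSpace ℝ (Fin d) → ℝ) (w : EuclideanSpace ℝ (Fin d))
    (hL : ContDiffAt ℝ 4 L w) (hcrit : gradient L w = 0)
    (hnondeg : (EdgeBranching.hess L w).IsInvertible) (ηc : ℝ) (hηc : 0 < ηc) :
    -- the branch at a nondegenerate critical direction
    (∀ u : EuclideanSpace ℝ (Fin d),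
      EdgeBranching.IsSphereNondegenerate (EdgeBranching.quartic L w)
        (EdgeBranching.critSpace L w ηc) u →
      EdgeBranching.quartic L w u ≠ 0 →
      ∃ (δ : ℝ) (c a : ℝ → EuclideanSpace ℝ (Fin d)) (α : ℝ → ℝ),
        0 < δ ∧ δ < ηc ∧
        -- the branch consists of period-two orbits and is continuous
        (∀ η ∈ EdgeBranching.branchSide ηc (EdgeBranching.quartic L w u), |η - ηc| < δ →
          EdgeBranching.IsPeriodTwoOrbit L η (c η - a η) (c η + a η) ∧ 0 < α η) ∧
        ContinuousOn c
          (EdgeBranching.branchSide ηc (EdgeBranching.quartic L w u) ∩ Metric.ball ηc δ) ∧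
        ContinuousOn a
          (EdgeBranching.branchSide ηc (EdgeBranching.quartic L w u) ∩ Metric.ball ηc δ) ∧
        -- it emanates from the critical point, with the stated amplitude
        Tendsto c (𝓝[EdgeBranching.branchSide ηc (EdgeBranching.quartic L w u)] ηc) (𝓝 w) ∧
        (fun η => a η - α η • u)
          =o[𝓝[EdgeBranching.branchSide ηc (EdgeBranching.quartic L w u)] ηc]
          (fun η => √|η - ηc|) ∧
        (fun η => α η ^ 2 - (2 / η - 2 / ηc) / EdgeBranching.quartic L w u)
          =o[𝓝[EdgeBranching.branchSide ηc (EdgeBranching.quartic L w u)] ηc]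
          (fun η => |η - ηc|) ∧
        -- uniqueness up to swapping the two points, and no orbit off the stated side
        (∀ (η : ℝ) (x y : EuclideanSpace ℝ (Fin d)), |η - ηc| < δ →
          EdgeBranching.IsPeriodTwoOrbit L η x y → ‖x - w‖ < δ → ‖y - w‖ < δ →
          (‖EdgeBranching.direction x y - u‖ < δ ∨ ‖EdgeBranching.direction x y + u‖ < δ) →
          η ∈ EdgeBranching.branchSide ηc (EdgeBranching.quartic L w u) ∧
          ((x = c η - a η ∧ y = c η + a η) ∨ (x = c η + a η ∧ y = c η - a η)))) ∧
    -- every small period-two orbit is tangent to a critical direction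
    (∀ ε > 0, ∃ δ > 0, ∀ (η : ℝ) (x y : EuclideanSpace ℝ (Fin d)), |η - ηc| < δ →
      EdgeBranching.IsPeriodTwoOrbit L η x y → ‖x - w‖ < δ → ‖y - w‖ < δ →
      ∃ v : EuclideanSpace ℝ (Fin d),
        EdgeBranching.IsSphereCritical (EdgeBranching.quartic L w)
          (EdgeBranching.critSpace L w ηc) v ∧
        ‖EdgeBranching.direction x y - v‖ < ε) ∧
    -- in the one-dimensional case the hypothesis on the direction is automatic
    (Module.finrank ℝ (EdgeBranching.critSpace L w ηc) = 1 →
      ∀ u ∈ EdgeBranching.critSpace L w ηc, ‖u‖ = 1 →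
        EdgeBranching.IsSphereNondegenerate (EdgeBranching.quartic L w)
          (EdgeBranching.critSpace L w ηc) u) := by
  exact ⟨fun u hu hq =>
      EdgeBranching.exists_branch_of_isSphereNondegenerate hL hcrit hnondeg hηc hu hq,
    fun ε hε => EdgeBranching.exists_critical_near_direction hL hcrit hnondeg hηc hε,
    fun hF u hu hu1 => EdgeBranching.isSphereNondegenerate_of_finrank_eq_one hF hu hu1⟩
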